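/- **Theorem 1.1.** Let $c\ge 1$, $m,k\ge 0$, and let $n_1,\dots,n_k\ge 0$ be integers with $n_{i+1}\mid n_i$ for all $1\le i\le k-1$. Write $\mathbf Z_n=\mathbf Z/n\mathbf Z$ (so $\mathbf Z_0=\mathbf Z$) and $A^{(r)}$ for the direct sum of $r$ copies of $A$. Let $$G\cong \mathbf Z^{(m)}\oplus\mathbf Z_{n_1}\oplus\mathbf Z_{n_2}\oplus\cdots\oplus\mathbf Z_{n_k}.$$ Let $\mathcal N_c$ be the variety of nilpotent groups of class at most $c$ and let $V$ be the set of its words, that is, of all words that are laws in every nilpotent group of class at most $c$. The $c$-nilpotent multiplier of $G$ is its Baer invariant with respect to $\mathcal N_c$: for a presentation $G\cong F/R$ with $F$ a free group, $$\mathcal N_cM(G)=\frac{R\cap V(F)}{[RV^*F]},$$ where $V(F)$ is the subgroup generated by all values in $F$ of words in $V$, and $[RV^*F]$ is the subgroup generated by all elements $$v(f_1,\dots,f_{i-1},f_ir,f_{i+1},\dots,f_n)\,v(f_1,\dots,f_n)^{-1}\qquad(v\in V,\ 1\le i\le n,\ f_1,\dots,f_n\in F,\ r\in R).$$ Let $b_i$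 be the number of basic commutators of weight $c+1$ on $i$ ordered letters. Here the letters are the basic commutators of weight $1$, and $[b,a]$ is a basic commutator of weight $n>1$ if $a,b$ are basic commutators whose weights add up to $n$, $a<b$, and $b=[b_1,b_2]$ implies $b_2\le a$; commutators are ordered first by weight, and those of equal weight greater than $1$ lexicographically, i.e. $[b_1,a_1]<[b_2,a_2]$ if $b_1<b_2$, or $b_1=b_2$ and $a_1<a_2$. Then $b_0=b_1=0$ and, for every such presentation $G\cong F/R$, $$\mathcal N_cM(G)\cong \mathbf Z^{(b_m)}\oplus\mathbf Z_{n_1}^{(b_{m+1}-b_m)}\oplus\mathbf Z_{n_2}^{(b_{m+2}-b_{m+1})}\oplus\cdots\oplus\mathbf Z_{n_k}^{(b_{m+k}-b_{m+k-1})}.$$ -/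

import Mathlib

/-! ### The Baer invariant of a group -/

namespace BaerInv

section

variable {F : Type*} [Group F]

/-- The verbal subgroup `V(F)`: the subgroup generated by all values in `F` of the words `v ∈ V`.
Words are elements of the free group on the countably many letters `x₀, x₁, …`, and
`FreeGroup.lift f v` is the value `v(f₀, f₁, …)`. -/
def verbalSubgroup (V : Set (FreeGroup ℕ)) (F : Type*) [Group F] : Subgroup F :=
  Subgroup.closure {g | ∃ v ∈ V, ∃ f : ℕ → F, g = FreeGroup.lift f v}

/-- The subgroup `[R V* F]`, generated by all
`v(f₁, …, fᵢ₋₁, fᵢ r, fᵢ₊₁, …, fₙ) v(f₁, …, fₙ)⁻¹` with `r ∈ R`, `v ∈ V`, `fⱼ ∈ F`. -/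
def marginalCommutator (V : Set (FreeGroup ℕ)) (R : Subgroup F) : Subgroup F :=
  Subgroup.closure {g | ∃ v ∈ V, ∃ f : ℕ → F, ∃ i : ℕ, ∃ r ∈ R,
    g = FreeGroup.lift (Function.update f i (f i * r)) v * (FreeGroup.lift f v)⁻¹}

theorem conj_lift (g : F) (f : ℕ → F) (v : FreeGroup ℕ) :
    g * FreeGroup.lift f v * g⁻¹ = FreeGroup.lift (fun j => g * f j * g⁻¹) v := by
  have h : (MulAut.conj g).toMonoidHom.comp (FreeGroup.lift f)
      = FreeGroup.lift (fun j => g * f j * g⁻¹) := by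
    ext j
    simp
  simpa using DFunLike.congr_fun h v

instance marginalCommutator_normal (V : Set (FreeGroup ℕ)) (R : Subgroup F) [hR : R.Normal] :
    (marginalCommutator V R).Normal := by
  refine ⟨fun x hx g => ?_⟩
  induction hx using Subgroup.closure_induction with
  | one => simp
  | mul a b _ _ ha hb =>
    have h : g * (a * b) * g⁻¹ = g * a * g⁻¹ * (g * b * g⁻¹) := by group
    rw [h]
    exact mul_mem ha hb
  | inv a _ ha =>
    have h : g * a⁻¹ * g⁻¹ = (g * a * g⁻¹)⁻¹ := by group
    rw [h]
    exact inv_mem ha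
  | mem a ha =>
    obtain ⟨v, hv, f, i, r, hr, rfl⟩ := ha
    refine Subgroup.subset_closure
      ⟨v, hv, fun j => g * f j * g⁻¹, i, g * r * g⁻¹, hR.conj_mem r hr g, ?_⟩
    have h1 : (Function.update (fun j => g * f j * g⁻¹) i (g * f i * g⁻¹ * (g * r * g⁻¹)))
        = fun j => g * Function.update f i (f i * r) j * g⁻¹ := by
      funext j
      by_cases hj : j = i
      · subst hj
        simp
      · simp [hj]
    rw [h1, ← conj_lift, ← conj_lift]
    group

/-- `[R V* F]` lies in `R ∩ V(F)`, so that the quotient below is the intended one. -/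
theorem marginalCommutator_le (V : Set (FreeGroup ℕ)) (R : Subgroup F) [hR : R.Normal] :
    marginalCommutator V R ≤ R ⊓ verbalSubgroup V F := by
  refine (Subgroup.closure_le _).2 ?_
  rintro g ⟨v, hv, f, i, r, hr, rfl⟩
  refine Subgroup.mem_inf.2 ⟨?_, (verbalSubgroup V F).mul_mem
    (Subgroup.subset_closure ⟨v, hv, _, rfl⟩)
    ((verbalSubgroup V F).inv_mem (Subgroup.subset_closure ⟨v, hv, _, rfl⟩))⟩
  have h : (QuotientGroup.mk' R).comp (FreeGroup.lift (Function.update f i (f i * r)))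
      = (QuotientGroup.mk' R).comp (FreeGroup.lift f) := by
    ext j
    by_cases hj : j = i
    · subst hj
      simp [hr]
    · simp [hj]
  have h2 := DFunLike.congr_fun h v
  rw [← QuotientGroup.eq_one_iff]
  simpa [mul_inv_eq_one] using h2

/-- The Baer invariant `(R ∩ V(F)) / [R V* F]` computed from a presentation `F / R`. -/
abbrev BaerInvariant (V : Set (FreeGroup ℕ)) (R : Subgroup F) [R.Normal] : Type _ :=
  ↥(R ⊓ verbalSubgroup V F) ⧸ (marginalCommutator V R).subgroupOf (R ⊓ verbalSubgroup V F)

end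

/-- The words of the variety `𝒩_c`: all words that are laws in every nilpotent group of class
at most `c`. -/
def nilpotentWords (c : ℕ) : Set (FreeGroup ℕ) :=
  {w | ∀ (H : Type) [Group H] [Group.IsNilpotent H], Group.nilpotencyClass H ≤ c →
    ∀ f : ℕ → H, FreeGroup.lift f w = 1}

/-- The `c`-nilpotent multiplier `𝒩_c M(G)` of `G ≅ F / R`, for `F` free. -/
abbrev NilpotentMultiplier (c : ℕ) {F : Type*} [Group F] (R : Subgroup F) [R.Normal] : Type _ :=
  BaerInvariant (nilpotentWords c) R

/-! ### Basic commutators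

Formal commutators in the letters `X` are the elements of the free magma on `X`, the product
`b * a` standing for `[b, a]`; the weight is `FreeMagma.length`. -/

section

variable {X Y : Type*}

/-- The order on formal commutators: letters are ordered as in `X`, smaller weight comes first,
and for equal weight `[b₁, a₁] < [b₂, a₂]` iff `b₁ < b₂`, or `b₁ = b₂` and `a₁ < a₂`. -/
def CommLT [LT X] : FreeMagma X → FreeMagma X → Prop
  | .of x, .of y => x < y
  | .of _, .mul _ _ => True
  | .mul _ _, .of _ => False
  | .mul b₁ a₁, .mul b₂ a₂ =>
    (b₁ * a₁).length < (b₂ * a₂).length ∨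
      ((b₁ * a₁).length = (b₂ * a₂).length ∧ (CommLT b₁ b₂ ∨ (b₁ = b₂ ∧ CommLT a₁ a₂)))

/-- If `b = [b₁, b₂]`, then `b₂ ≤ a`. -/
def RightLE [LT X] : FreeMagma X → FreeMagma X → Prop
  | .of _, _ => True
  | .mul _ b₂, a => CommLT b₂ a ∨ b₂ = a

/-- Letters are basic commutators, and `[b, a]` is a basic commutator iff `b` and `a` are basic
commutators, `a < b`, and `b = [b₁, b₂]` implies `b₂ ≤ a`. -/
def IsBasicCommutator [LT X] : FreeMagma X → Prop
  | .of _ => True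
  | .mul b a => IsBasicCommutator b ∧ IsBasicCommutator a ∧ CommLT a b ∧ RightLE b a

/-- The number of basic commutators of weight `n` on `i` letters. -/
noncomputable def numBasicCommutators (n i : ℕ) : ℕ :=
  Nat.card {t : FreeMagma (Fin i) // IsBasicCommutator t ∧ t.length = n}

theorem finite_length [Finite X] (n : ℕ) : {t : FreeMagma X | t.length ≤ n}.Finite := by
  induction n with
  | zero =>
    refine Set.Finite.subset Set.finite_empty fun t ht => ?_
    have h := t.length_pos
    simp only [Set.mem_ofPred_eq] at ht
    omega
  | succ n ih =>
    refine ((Set.finite_range (FreeMagma.of (α := X))).union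
      (Set.Finite.image2 (fun b a : FreeMagma X => b * a) ih ih)).subset fun t ht => ?_
    cases t with
    | of x => exact Or.inl ⟨x, rfl⟩
    | mul b a =>
      have hb := b.length_pos
      have ha := a.length_pos
      have hl : b.length + a.length ≤ n + 1 := ht
      refine Or.inr ⟨b, ?_, a, ?_, rfl⟩ <;> simp only [Set.mem_ofPred_eq] <;> omega

/-- There are finitely many basic commutators of a given weight on finitely many letters. -/
instance finite_basic (n i : ℕ) :
    Finite {t : FreeMagma (Fin i) // IsBasicCommutator t ∧ t.length = n} :=
  ((finite_length n).subset fun _ ht => le_of_eq ht.2).to_subtype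

theorem length_map (e : X → Y) (t : FreeMagma X) : (FreeMagma.map e t).length = t.length := by
  induction t with
  | ih1 x => rfl
  | ih2 b a hb ha => exact congrArg₂ (· + ·) hb ha

theorem map_injective {e : X → Y} (he : Function.Injective e) :
    Function.Injective (FreeMagma.map e) := by
  intro s
  induction s with
  | ih1 x =>
    intro t h
    cases t with
    | of y =>
      change FreeMagma.of (e x) = FreeMagma.of (e y) at h
      injection h with h1
      rw [he h1]
    | mul b a => exact absurd h (by intro h; cases h)
  | ih2 b a hb ha =>
    intro t h
    cases t with
    | of y => exact absurd h (by intro h; cases h)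
    | mul b' a' =>
      change FreeMagma.mul (FreeMagma.map e b) (FreeMagma.map e a)
        = FreeMagma.mul (FreeMagma.map e b') (FreeMagma.map e a') at h
      injection h with h1 h2
      rw [hb h1, ha h2]
      rfl

theorem commLT_map [LT X] [LT Y] {e : X → Y} (he : ∀ x y, x < y → e x < e y)
    {s t : FreeMagma X} (h : CommLT s t) : CommLT (FreeMagma.map e s) (FreeMagma.map e t) := by
  induction s generalizing t with
  | ih1 x =>
    cases t with
    | of y => exact he _ _ h
    | mul b a => trivial
  | ih2 b a hb ha =>
    cases t with
    | of y => exact h.elim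
    | mul b' a' =>
      have h1 := length_map e (b * a)
      have h2 := length_map e (b' * a')
      rcases h with h | ⟨h, h' | ⟨rfl, h'⟩⟩
      · exact Or.inl (h1.trans_lt (h.trans_eq h2.symm))
      · exact Or.inr ⟨h1.trans (h.trans h2.symm), Or.inl (hb h')⟩
      · exact Or.inr ⟨h1.trans (h.trans h2.symm), Or.inr ⟨rfl, ha h'⟩⟩

theorem isBasic_map [LT X] [LT Y] {e : X → Y} (he : ∀ x y, x < y → e x < e y)
    {t : FreeMagma X} (h : IsBasicCommutator t) : IsBasicCommutator (FreeMagma.map e t) := by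
  induction t with
  | ih1 x => trivial
  | ih2 b a hb ha =>
    obtain ⟨h1, h2, h3, h4⟩ := h
    refine ⟨hb h1, ha h2, commLT_map he h3, ?_⟩
    cases b with
    | of x => trivial
    | mul b₁ b₂ => exact h4.imp (commLT_map he) (fun h => congrArg _ h)

/-- The number of basic commutators of weight `n` does not decrease when letters are added, so
differences of these numbers may be taken in `ℕ`. -/
theorem numBasicCommutators_mono (n : ℕ) : Monotone (numBasicCommutators n) := by
  intro i j hij
  have he : ∀ x y : Fin i, x < y → Fin.castLE hij x < Fin.castLE hij y := fun _ _ h => h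
  exact Nat.card_le_card_of_injective
    (fun t : {t : FreeMagma (Fin i) // IsBasicCommutator t ∧ t.length = n} =>
      (⟨FreeMagma.map (Fin.castLE hij) t.1, isBasic_map he t.2.1, (length_map _ _).trans t.2.2⟩ :
        {t : FreeMagma (Fin j) // IsBasicCommutator t ∧ t.length = n}))
    fun s t h => Subtype.ext (map_injective (Fin.castLE_injective hij) (congrArg Subtype.val h))

end

end BaerInv

open scoped commutatorElement

namespace BaerInv

/-! ### The total order on formal commutators -/

section Order

variable {X : Type*} [LinearOrder X]

/-! Write γ for the (c+1)-st term of the lower central series of `F` and D for [R, F, …, F] with c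
factors F. For the words of class c the verbal subgroup is γ (`verbalSubgroup_nilpotentWords`) and
[R V* F] is D (`marginalCommutator_nilpotentWords`). As `F ⧸ R` is abelian and c ≥ 1, γ lies in `R`,
so the multiplier is γ/D. The claim becomes that γ/D is the direct sum of ℤ/d(j) over the basic
commutators t of weight c+1 on m+k letters, where j is the greatest letter of t and d(j) is the
order of the j-th cyclic factor of G, or 0 if that factor is infinite
(`nonempty_cseries_quotient_equiv`).

Upper bound: lift the standard generators of G to elements y_j of F. Collection by the Jacobi
identity shows that the basic commutators in the y_j generate γ modulo D (`cseries_top_le_closure`).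
If j occurs in t, then y_j^d(j) lies in R and hence t^d(j) lies in D (`groupEval_pow_mem`). By the
divisibility chain the greatest letter gives the strongest of these relations.

Lower bound: for each j let A be the free associative algebra over ℤ/d(j), and represent F à la
Magnus by power series 1 + X(…) over A whose linear part factors through `F ⧸ R` and kills the
letters beyond j. The coefficient of X^(c+1) is then a homomorphism on γ which turns group
commutators into ring commutators and vanishes on D (`exists_lead`). Functionals on A dual to the
basic commutators (`exists_dual_basicCommutators`) read off the exponent of each t modulo d(j), so
there are no further relations.

Finally, the basic commutators whose greatest letter is the j-th one number b_j - b_(j-1), which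
gives the multiplicities (`card_maxLetter_eq`). -/

theorem commLT_of_length_lt {s t : FreeMagma X} (h : s.length < t.length) : CommLT s t := by
  have hs := s.length_pos
  cases t with
  | of y => exact absurd h (by change ¬ s.length < 1; omega)
  | mul b a =>
    cases s with
    | of x => trivial
    | mul b' a' => exact Or.inl h

theorem CommLT.length_le {s t : FreeMagma X} (h : CommLT s t) : s.length ≤ t.length := by
  have ht := t.length_pos
  cases s with
  | of x => exact ht
  | mul b a =>
    cases t with
    | of y => exact h.elim
    | mul b' a' => exact h.elim le_of_lt fun h => h.1.le

theorem CommLT.irrefl (t : FreeMagma X) : ¬ CommLT t t := by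
  induction t with
  | ih1 x => exact lt_irrefl x
  | ih2 b a hb ha =>
    rintro (h | ⟨-, h | ⟨-, h⟩⟩)
    · exact lt_irrefl _ h
    · exact hb h
    · exact ha h

theorem CommLT.trans {s t u : FreeMagma X} (h : CommLT s t) (h' : CommLT t u) : CommLT s u := by
  induction s generalizing t u with
  | ih1 x =>
    cases u with
    | mul b a => trivial
    | of z =>
      cases t with
      | of y => exact lt_trans h h'
      | mul b a => exact h'.elim
  | ih2 b a hb ha =>
    cases t with
    | of y => exact h.elim
    | mul b' a' =>
      cases u with
      | of z => exact h'.elim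
      | mul b'' a'' =>
        rcases h with h | ⟨h, h1⟩
        · exact Or.inl (h.trans_le (CommLT.length_le h'))
        rcases h' with h' | ⟨h', h2⟩
        · exact Or.inl (h.trans_lt h')
        refine Or.inr ⟨h.trans h', ?_⟩
        rcases h1 with h1 | ⟨rfl, h1⟩ <;> rcases h2 with h2 | ⟨rfl, h2⟩
        · exact Or.inl (hb h1 h2)
        · exact Or.inl h1
        · exact Or.inl h2
        · exact Or.inr ⟨rfl, ha h1 h2⟩

theorem CommLT.trichotomous (s t : FreeMagma X) : CommLT s t ∨ s = t ∨ CommLT t s := by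
  induction s generalizing t with
  | ih1 x =>
    cases t with
    | of y => exact (lt_trichotomy x y).imp id fun h => h.imp (congrArg _) id
    | mul b a => exact Or.inl trivial
  | ih2 b a hb ha =>
    cases t with
    | of y => exact Or.inr (Or.inr trivial)
    | mul b' a' =>
      rcases lt_trichotomy (b * a).length (b' * a').length with h | h | h
      · exact Or.inl (Or.inl h)
      · rcases hb b' with h1 | rfl | h1
        · exact Or.inl (Or.inr ⟨h, Or.inl h1⟩)
        · rcases ha a' with h2 | rfl | h2
          · exact Or.inl (Or.inr ⟨h, Or.inr ⟨rfl, h2⟩⟩)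
          · exact Or.inr (Or.inl rfl)
          · exact Or.inr (Or.inr (Or.inr ⟨h.symm, Or.inr ⟨rfl, h2⟩⟩))
        · exact Or.inr (Or.inr (Or.inr ⟨h.symm, Or.inl h1⟩))
      · exact Or.inr (Or.inr (Or.inl h))

instance : IsStrictTotalOrder (FreeMagma X) CommLT where
  irrefl := CommLT.irrefl
  trans _ _ _ := CommLT.trans
  trichotomous s t h h' := by
    rcases CommLT.trichotomous s t with h1 | h1 | h1
    exacts [(h h1).elim, h1, (h' h1).elim]

open Classical in
/-- The linear order on formal commutators with strict part `CommLT`. -/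
noncomputable instance : LinearOrder (FreeMagma X) := linearOrderOfSTO CommLT

theorem lt_of_length_lt {s t : FreeMagma X} (h : s.length < t.length) : s < t :=
  commLT_of_length_lt h

theorem lt_mul_right (b a : FreeMagma X) : a < b * a :=
  lt_of_length_lt (by have := b.length_pos; change _ < b.length + a.length; omega)

theorem rightLE_mul {b₁ b₂ a : FreeMagma X} : RightLE (b₁ * b₂) a ↔ b₂ ≤ a :=
  ⟨fun h => h.elim (fun h => le_of_lt (α := FreeMagma X) h) le_of_eq,
    fun h => (lt_or_eq_of_le h).imp id id⟩

theorem RightLE.trans {b a a' : FreeMagma X} (h : RightLE b a) (h' : a ≤ a') : RightLE b a' := by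
  cases b with
  | of x => trivial
  | mul b₁ b₂ => exact rightLE_mul.2 ((rightLE_mul.1 h).trans h')

/-- A right factor has smaller weight than the whole, hence precedes it. -/
theorem rightLE_of_le {b a : FreeMagma X} (h : b ≤ a) : RightLE b a := by
  cases b with
  | of x => trivial
  | mul b₁ b₂ => exact rightLE_mul.2 ((lt_mul_right b₁ b₂).le.trans h)

theorem isBasic_mul {b a : FreeMagma X} : IsBasicCommutator (b * a) ↔
    IsBasicCommutator b ∧ IsBasicCommutator a ∧ a < b ∧ RightLE b a := Iff.rfl

end Order

/-! ### Increasing lists of basic commutators are determined by their words -/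

section Foliage

variable {X : Type*} [LinearOrder X]

/-- The letters of a formal commutator, from left to right. -/
def foliage {X : Type*} : FreeMagma X → List X
  | .of x => [x]
  | .mul b a => foliage b ++ foliage a

theorem length_foliage {X : Type*} (t : FreeMagma X) : (foliage t).length = t.length := by
  induction t with
  | ih1 x => rfl
  | ih2 b a hb ha =>
    change (foliage b ++ foliage a).length = b.length + a.length
    rw [List.length_append, hb, ha]

/-- Insertion of a formal commutator into an increasing list, bracketing with the smaller entries
met on the way. -/
noncomputable def insertComm : FreeMagma X → List (FreeMagma X) → List (FreeMagma X)
  | h, [] => [h]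
  | h, a :: s => if a < h then insertComm (h * a) s else h :: a :: s

/-- Increasing lists of basic commutators. -/
def IsStandard (s : List (FreeMagma X)) : Prop :=
  (∀ t ∈ s, IsBasicCommutator t) ∧ s.Pairwise (· ≤ ·)

theorem isStandard_cons {h : FreeMagma X} {s : List (FreeMagma X)} :
    IsStandard (h :: s) ↔ IsBasicCommutator h ∧ (∀ a ∈ s, h ≤ a) ∧ IsStandard s := by
  simp only [IsStandard, List.forall_mem_cons, List.pairwise_cons]
  tauto

theorem insertComm_of_le {h : FreeMagma X} {s : List (FreeMagma X)} (hs : ∀ a ∈ s, h ≤ a) :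
    insertComm h s = h :: s := by
  cases s with
  | nil => rfl
  | cons a s => exact if_neg (not_lt.2 (hs a (by simp)))

/-- Inserting the letters of h one by one, from the right, rebuilds h: for h = [b, a], first a is
formed and stays at the front because a is at most every entry of s, then b meets a < b and is
bracketed with it. The condition on h is weaker than h ≤ s so that the induction can pass to b. -/
theorem foldr_foliage {h : FreeMagma X} {s : List (FreeMagma X)} (hh : IsBasicCommutator h)
    (hs : IsStandard s) (hr : ∀ a ∈ s, RightLE h a) :
    (foliage h).foldr (fun x s => insertComm (.of x) s) s = insertComm h s := by
  induction h generalizing s with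
  | ih1 x => rfl
  | ih2 b a hb ha =>
    obtain ⟨h1, h2, h3, h4⟩ := isBasic_mul.1 hh
    have hle : ∀ d ∈ s, a ≤ d := fun d hd => rightLE_mul.1 (hr d hd)
    change (foliage b ++ foliage a).foldr _ s = _
    rw [List.foldr_append, ha h2 hs fun d hd => rightLE_of_le (hle d hd), insertComm_of_le hle,
      hb h1 (isStandard_cons.2 ⟨h2, hle, hs⟩)]
    · exact if_pos h3
    · intro d hd
      rcases List.mem_cons.1 hd with rfl | hd
      · exact h4
      · exact h4.trans (hle d hd)

/-- An increasing list of basic commutators is determined by its letters. -/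
theorem foldr_flatMap_foliage {s : List (FreeMagma X)} (hs : IsStandard s) :
    (s.flatMap foliage).foldr (fun x s => insertComm (.of x) s) [] = s := by
  induction s with
  | nil => rfl
  | cons h s ih =>
    obtain ⟨h1, h2, h3⟩ := isStandard_cons.1 hs
    rw [List.flatMap_cons, List.foldr_append, ih h3,
      foldr_foliage h1 h3 fun a ha => rightLE_of_le (h2 a ha), insertComm_of_le h2]

/-- This bounds the number of increasing lists of total weight n by the number of words of length n.
-/
theorem flatMap_foliage_injOn :
    Set.InjOn (fun s : List (FreeMagma X) => s.flatMap foliage) {s | IsStandard s} := by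
  intro s hs t ht h
  rw [← foldr_flatMap_foliage hs, ← foldr_flatMap_foliage ht]
  exact congrArg _ h

end Foliage

/-! ### Products of basic commutators span the free associative algebra -/

section Span

variable {X : Type*} {A : Type*} [Ring A]

/-- The value of a formal commutator in a ring, with `[b, a] = b a - a b`. -/
def ringEval (x : X → A) : FreeMagma X → A
  | .of i => x i
  | .mul b a => ringEval x b * ringEval x a - ringEval x a * ringEval x b

theorem ringEval_mul (x : X → A) (b a : FreeMagma X) :
    ringEval x (b * a) = ringEval x b * ringEval x a - ringEval x a * ringEval x b := rfl

variable [LinearOrder X] (K : Type*) [CommRing K] [Algebra K A]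

/-- Collection in a ring: if a < h, replace h a by [h, a] + a h and continue in the shorter tail.
The bound l keeps track of the smallest entry, so that a may be put back in front of the results of
the second summand. -/
theorem ringEval_mul_prod_mem_span (x : X → A) (s : List (FreeMagma X)) (h l : FreeMagma X)
    (hh : IsBasicCommutator h) (hs : IsStandard s) (hr : ∀ a ∈ s, RightLE h a)
    (hl : l ≤ h) (hls : ∀ a ∈ s, l ≤ a) :
    ringEval x h * (s.map (ringEval x)).prod ∈ Submodule.span K
      {p | ∃ u : List (FreeMagma X), IsStandard u ∧ (∀ a ∈ u, l ≤ a) ∧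
        (u.flatMap foliage).length = h.length + (s.flatMap foliage).length ∧
        p = (u.map (ringEval x)).prod} := by
  induction s generalizing h l with
  | nil => exact Submodule.subset_span ⟨[h], isStandard_cons.2 ⟨hh, by simp, hs⟩, by simpa using hl,
      by simp [length_foliage], by simp⟩
  | cons a s ih =>
    obtain ⟨ha, has, hs'⟩ := isStandard_cons.1 hs
    rcases le_or_gt h a with hle | hlt
    · refine Submodule.subset_span ⟨h :: a :: s, isStandard_cons.2 ⟨hh, ?_, hs⟩, ?_, ?_, by simp⟩
      · intro d hd
        rcases List.mem_cons.1 hd with rfl | hd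
        exacts [hle, hle.trans (has d hd)]
      · intro d hd
        rcases List.mem_cons.1 hd with rfl | hd
        exacts [hl, hls d hd]
      · simp [length_foliage]
    · have hla : l ≤ a := hls a (by simp)
      have key : ringEval x h * ((a :: s).map (ringEval x)).prod
          = ringEval x (h * a) * (s.map (ringEval x)).prod
            + ringEval x a * (ringEval x h * (s.map (ringEval x)).prod) := by
        rw [ringEval_mul, List.map_cons, List.prod_cons]
        noncomm_ring
      rw [key]
      refine add_mem ?_ ?_
      · have := ih (h * a) l (isBasic_mul.2 ⟨hh, ha, hlt, hr a (by simp)⟩) hs'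
          (fun d hd => rightLE_mul.2 (has d hd)) (hla.trans (lt_mul_right h a).le)
          (fun d hd => hls d (by simp [hd]))
        refine Submodule.span_mono ?_ this
        rintro p ⟨u, h1, h2, h3, h4⟩
        refine ⟨u, h1, h2, ?_, h4⟩
        rw [h3]
        change h.length + a.length + _ = _
        simp [length_foliage, add_assoc]
      · have := ih h a hh hs' (fun d hd => hr d (by simp [hd])) hlt.le has
        have h5 := Submodule.mem_map_of_mem (f := LinearMap.mulLeft K (ringEval x a)) this
        rw [Submodule.map_span] at h5
        refine Submodule.span_mono ?_ h5
        rintro _ ⟨_, ⟨u, h1, h2, h3, rfl⟩, rfl⟩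
        refine ⟨a :: u, isStandard_cons.2 ⟨ha, h2, h1⟩, ?_, ?_, by simp⟩
        · intro d hd
          rcases List.mem_cons.1 hd with rfl | hd
          exacts [hla, hla.trans (h2 d hd)]
        · simp only [List.flatMap_cons, List.length_append, h3, length_foliage]
          omega

theorem prod_mem_span_standard (x : X → A) (w : List X) :
    (w.map x).prod ∈ Submodule.span K {p | ∃ u : List (FreeMagma X), IsStandard u ∧
      (u.flatMap foliage).length = w.length ∧ p = (u.map (ringEval x)).prod} := by
  induction w with
  | nil => exact Submodule.subset_span ⟨[], ⟨by simp, by simp⟩, rfl, rfl⟩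
  | cons i w ih =>
    have h5 := Submodule.mem_map_of_mem (f := LinearMap.mulLeft K (x i)) ih
    rw [Submodule.map_span] at h5
    refine (Submodule.span_le.2 ?_) h5
    rintro _ ⟨_, ⟨u, h1, h2, rfl⟩, rfl⟩
    -- Any common lower bound will do here; its value is forgotten at the end.
    obtain ⟨l, hl⟩ : ∃ l : FreeMagma X, l ≤ .of i ∧ ∀ a ∈ u, l ≤ a := by
      clear h2
      induction u with
      | nil => exact ⟨.of i, le_rfl, by simp⟩
      | cons b u ih =>
        obtain ⟨l, hl, hl'⟩ := ih (isStandard_cons.1 h1).2.2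
        refine ⟨min l b, (min_le_left _ _).trans hl, fun a ha => ?_⟩
        rcases List.mem_cons.1 ha with rfl | ha
        exacts [min_le_right _ _, (min_le_left _ _).trans (hl' a ha)]
    refine Submodule.span_mono ?_
      (ringEval_mul_prod_mem_span K x u (.of i) l trivial h1 (fun _ _ => trivial) hl.1 hl.2)
    rintro p ⟨u', h3, -, h4, h6⟩
    refine ⟨u', h3, ?_, h6⟩
    rw [h4, h2, List.length_cons, add_comm]
    rfl

end Span

/-! ### Linear independence of basic commutators in the free associative algebra -/

section Dual

variable {X : Type*} [LinearOrder X] [Finite X] (K : Type*) [CommRing K]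

/-- The letters in the free associative algebra. -/
noncomputable def letter (i : X) : MonoidAlgebra K (FreeMonoid X) :=
  MonoidAlgebra.of K (FreeMonoid X) (FreeMonoid.of i)

/-- Basic commutators of a given weight are linearly independent in the free associative algebra,
and their span is a direct summand. -/
theorem exists_dual_basicCommutators (n : ℕ) :
    ∃ ψ : FreeMagma X → MonoidAlgebra K (FreeMonoid X) →ₗ[K] K,
      ∀ s t, IsBasicCommutator s → s.length = n → IsBasicCommutator t → t.length = n →
        ψ t (ringEval (letter K) s) = if s = t then 1 else 0 := by
  classical
  let W := {w : List X // w.length = n}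
  let S := {u : List (FreeMagma X) // IsStandard u ∧ (u.flatMap foliage).length = n}
  have : Finite W := inferInstanceAs (Finite (List.Vector X n))
  let j : S → W := fun u => ⟨u.1.flatMap foliage, u.2.2⟩
  have hj : Function.Injective j := fun u v h =>
    Subtype.ext (flatMap_foliage_injOn u.2.1 v.2.1 (congrArg Subtype.val h))
  have : Finite S := Finite.of_injective j hj
  have : Fintype S := Fintype.ofFinite S
  have : Fintype W := Fintype.ofFinite W
  let P : S → MonoidAlgebra K (FreeMonoid X) := fun u => (u.1.map (ringEval (letter K))).prod
  let u' : (S → K) →ₗ[K] MonoidAlgebra K (FreeMonoid X) := Fintype.linearCombination K P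
  let π : MonoidAlgebra K (FreeMonoid X) →ₗ[K] (W → K) :=
    LinearMap.pi fun w => (Finsupp.lapply (FreeMonoid.ofList w.1)).comp
      (MonoidAlgebra.coeffLinearEquiv K).toLinearMap
  let ρ : (W → K) →ₗ[K] (S → K) := LinearMap.funLeft K K j
  have hρ : Function.Surjective ρ := LinearMap.funLeft_surjective_of_injective K K j hj
  have hw : ∀ w : W, (w.1.map (letter K)).prod =
      MonoidAlgebra.single (FreeMonoid.ofList w.1) 1 := by
    intro w
    have : ∀ w : List X, (w.map (letter K)).prod = MonoidAlgebra.of K _ (FreeMonoid.ofList w) := by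
      intro w
      induction w with
      | nil => exact (map_one (MonoidAlgebra.of K (FreeMonoid X))).symm
      | cons i w ih => rw [List.map_cons, List.prod_cons, ih, letter, ← map_mul]; rfl
    exact this w.1
  -- Every word of length n is a combination of standard products of total weight n.
  have hsurj : Function.Surjective (π.comp u') := by
    rw [← LinearMap.range_eq_top, eq_top_iff, ← (Pi.basisFun K W).span_eq, Submodule.span_le]
    rintro _ ⟨w, rfl⟩
    have h1 : (w.1.map (letter K)).prod ∈ LinearMap.range u' := by
      rw [Fintype.range_linearCombination]
      refine Submodule.span_mono ?_ (prod_mem_span_standard K (letter K) w.1)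
      rintro p ⟨u, hu, hu', rfl⟩
      exact ⟨⟨u, hu, hu'.trans w.2⟩, rfl⟩
    obtain ⟨a, ha⟩ := h1
    refine ⟨a, ?_⟩
    rw [LinearMap.comp_apply, ha, hw]
    ext v
    simp only [Pi.basisFun_apply, π, LinearMap.pi_apply, LinearMap.comp_apply, LinearEquiv.coe_coe,
      MonoidAlgebra.coeffLinearEquiv_apply, MonoidAlgebra.coeff_single, Finsupp.lapply_apply,
      Finsupp.single_apply, Pi.single_apply, EmbeddingLike.apply_eq_iff_eq]
    exact if_congr (Subtype.ext_iff.symm.trans eq_comm) rfl rfl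
  have hinj : Function.Injective (π.comp u') := by
    -- There are at most as many standard products as words, so a spanning family of this size is a
    -- basis. Precomposing with `ρ` gives a surjective endomorphism of a finitely generated module,
    -- which is injective; surjectivity of `ρ` passes this on to `π.comp u'`.
    have h1 : Function.Injective ((π.comp u').comp ρ) :=
      OrzechProperty.injective_of_surjective_endomorphism _ (hsurj.comp hρ)
    exact Function.Injective.of_comp_right (f := π.comp u') h1 hρ
  let E := LinearEquiv.ofBijective (π.comp u') ⟨hinj, hsurj⟩
  have hS : ∀ t : FreeMagma X, IsBasicCommutator t → t.length = n →
      IsStandard [t] ∧ ([t].flatMap foliage).length = n := fun t h1 h2 =>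
    ⟨⟨by simpa using h1, by simp⟩, by simpa [length_foliage] using h2⟩
  -- A basic commutator is itself a standard product with one factor, so its dual functional is a
  -- coordinate in the basis of standard products; elsewhere the value 0 is a dummy.
  refine ⟨fun t => if h : IsBasicCommutator t ∧ t.length = n then
    (LinearMap.proj ⟨[t], hS t h.1 h.2⟩).comp (E.symm.toLinearMap.comp π) else 0, ?_⟩
  intro s t hs hsn ht htn
  beta_reduce
  rw [dif_pos ⟨ht, htn⟩]
  have h1 : ringEval (letter K) s = u' (Pi.single ⟨[s], hS s hs hsn⟩ 1) := by
    simp [u', P, Fintype.linearCombination_apply_single]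
  have h2 : E.symm (π (ringEval (letter K) s)) = Pi.single ⟨[s], hS s hs hsn⟩ 1 := by
    rw [h1, LinearEquiv.symm_apply_eq]
    rfl
  simp only [LinearMap.comp_apply, LinearEquiv.coe_coe, h2, LinearMap.proj_apply, Pi.single_apply]
  refine if_congr ⟨fun h => ?_, fun h => ?_⟩ rfl rfl
  · exact (List.cons.inj (congrArg Subtype.val h)).1.symm
  · exact Subtype.ext (by simp [h])

end Dual

/-! ### The series [R, F, …, F] -/

section Series

variable {F : Type*} [Group F]

/-- The series `R, R, [R, F], [R, F, F], …`, indexed by weight. -/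
def cseries (R : Subgroup F) : ℕ → Subgroup F
  | 0 => R
  | 1 => R
  | n + 2 => ⁅cseries R (n + 1), ⊤⁆

variable (R : Subgroup F)

theorem cseries_succ_succ (n : ℕ) : cseries R (n + 2) = ⁅cseries R (n + 1), ⊤⁆ := rfl

instance cseries_normal [R.Normal] (n : ℕ) : (cseries R n).Normal := by
  induction n with
  | zero => assumption
  | succ n ih =>
    cases n with
    | zero => assumption
    | succ n => exact Subgroup.commutator_normal _ _

theorem commutator_cseries_top_le [R.Normal] (n : ℕ) : ⁅cseries R n, ⊤⁆ ≤ cseries R (n + 1) := by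
  cases n with
  | zero => exact Subgroup.commutator_le_left R ⊤
  | succ n => exact le_rfl

theorem cseries_antitone [R.Normal] : Antitone (cseries R) := by
  refine antitone_nat_of_succ_le fun n => ?_
  cases n with
  | zero => exact le_rfl
  | succ n => exact Subgroup.commutator_le_left _ _

theorem cseries_mono {R S : Subgroup F} (h : R ≤ S) (n : ℕ) : cseries R n ≤ cseries S n := by
  induction n with
  | zero => exact h
  | succ n ih =>
    cases n with
    | zero => exact h
    | succ n => exact Subgroup.commutator_mono ih le_rfl

theorem cseries_top_succ (n : ℕ) :
    cseries (⊤ : Subgroup F) (n + 1) = (⊤ : Subgroup F).lowerCentralSeries n := by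
  induction n with
  | zero => rfl
  | succ n ih => rw [cseries_succ_succ, ih, Subgroup.lowerCentralSeries_succ]

/-- The three subgroups lemma relative to a normal subgroup. -/
theorem commutator_commutator_le_of_rotate {H₁ H₂ H₃ N : Subgroup F} [N.Normal]
    (h1 : ⁅⁅H₂, H₃⁆, H₁⁆ ≤ N) (h2 : ⁅⁅H₃, H₁⁆, H₂⁆ ≤ N) : ⁅⁅H₁, H₂⁆, H₃⁆ ≤ N := by
  have key : ∀ H : Subgroup F, H ≤ N ↔ H.map (QuotientGroup.mk' N) = ⊥ := fun H => by
    rw [Subgroup.map_eq_bot_iff, QuotientGroup.ker_mk']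
  simp only [key, Subgroup.map_commutator] at *
  exact Subgroup.commutator_commutator_eq_bot_of_rotate h1 h2

/-- The usual proof that [γ_m, γ_n] ≤ γ_(m+n), by induction on m with the three subgroups lemma,
with one lower central series replaced by that of R. -/
theorem commutator_cseries_le [R.Normal] (m n : ℕ) :
    ⁅cseries (⊤ : Subgroup F) m, cseries R n⁆ ≤ cseries R (m + n) := by
  induction m generalizing n with
  | zero => exact (Subgroup.commutator_le_right _ _).trans_eq (by rw [zero_add])
  | succ m ih =>
    cases m with
    | zero =>
      rw [zero_add, add_comm, Subgroup.commutator_comm]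
      exact commutator_cseries_top_le R n
    | succ m =>
      refine commutator_commutator_le_of_rotate ?_ ?_
      · have h1 : ⁅(⊤ : Subgroup F), cseries R n⁆ ≤ cseries R (n + 1) := by
          rw [Subgroup.commutator_comm]
          exact commutator_cseries_top_le R n
        refine (Subgroup.commutator_mono h1 le_rfl).trans ?_
        rw [Subgroup.commutator_comm]
        exact (ih (n + 1)).trans_eq (by congr 1; omega)
      · refine (Subgroup.commutator_mono ((Subgroup.commutator_comm _ _).trans_le (ih n))
          le_rfl).trans ?_
        exact (commutator_cseries_top_le R _).trans_eq (by congr 1; omega)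

variable {R}

theorem commutator_mem_cseries [R.Normal] {m n k : ℕ} {x z : F}
    (hx : x ∈ cseries (⊤ : Subgroup F) m) (hz : z ∈ cseries R n) (hk : k ≤ m + n) :
    ⁅x, z⁆ ∈ cseries R k :=
  cseries_antitone R hk (commutator_cseries_le R m n (Subgroup.commutator_mem_commutator hx hz))

theorem commutator_mem_cseries' [R.Normal] {m n k : ℕ} {x z : F}
    (hx : x ∈ cseries R m) (hz : z ∈ cseries (⊤ : Subgroup F) n) (hk : k ≤ m + n) :
    ⁅x, z⁆ ∈ cseries R k := by
  rw [← commutatorElement_inv]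
  exact inv_mem (commutator_mem_cseries hz hx (by omega))

theorem cseries_top_succ_le [R.Normal] (hR : _root_.commutator F ≤ R) (n : ℕ) :
    cseries (⊤ : Subgroup F) (n + 2) ≤ cseries R (n + 1) := by
  induction n with
  | zero => exact hR
  | succ n ih => exact Subgroup.commutator_mono ih le_rfl

end Series

/-! ### Commutators are multilinear and satisfy Jacobi modulo the next term -/

section Multilinear

variable {F : Type*} [Group F]

/-- Modulo terms of weight m + n + 1 the commutator is additive in its left entry, so membership in
T need only be tested on generators. -/
theorem commutator_closure_left_mem {E : Set F} {m n : ℕ} (hm : 1 ≤ m) {T : Subgroup F}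
    (hT : cseries ⊤ (m + n + 1) ≤ T) (hE : E ⊆ cseries (⊤ : Subgroup F) m) {z : F}
    (hz : z ∈ cseries (⊤ : Subgroup F) n) (h : ∀ e ∈ E, ⁅e, z⁆ ∈ T) {x : F}
    (hx : x ∈ Subgroup.closure E) : ⁅x, z⁆ ∈ T := by
  have hE' : Subgroup.closure E ≤ cseries ⊤ m := (Subgroup.closure_le _).2 hE
  induction hx using Subgroup.closure_induction with
  | mem e he => exact h e he
  | one => simp
  | mul x x' hx hx' ih ih' =>
    have key : ⁅x * x', z⁆ = ⁅x, ⁅x', z⁆⁆ * ⁅x', z⁆ * ⁅x, z⁆ := by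
      simp only [commutatorElement_def]; group
    rw [key]
    exact mul_mem (mul_mem (hT (commutator_mem_cseries (hE' hx)
      (commutator_mem_cseries (hE' hx') hz le_rfl) (by omega))) ih') ih
  | inv x hx ih =>
    have key : ⁅x⁻¹, z⁆ = ⁅x⁻¹, ⁅x, z⁆⁻¹⁆ * ⁅x, z⁆⁻¹ := by
      simp only [commutatorElement_def]; group
    rw [key]
    exact mul_mem (hT (commutator_mem_cseries (inv_mem (hE' hx))
      (inv_mem (commutator_mem_cseries (hE' hx) hz le_rfl)) (by omega))) (inv_mem ih)

theorem commutator_closure_right_mem {E : Set F} {m n : ℕ} (hm : 1 ≤ m) {T : Subgroup F}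
    (hT : cseries ⊤ (m + n + 1) ≤ T) (hE : E ⊆ cseries (⊤ : Subgroup F) m) {z : F}
    (hz : z ∈ cseries (⊤ : Subgroup F) n) (h : ∀ e ∈ E, ⁅z, e⁆ ∈ T) {x : F}
    (hx : x ∈ Subgroup.closure E) : ⁅z, x⁆ ∈ T := by
  rw [← commutatorElement_inv]
  refine inv_mem (commutator_closure_left_mem hm hT hE hz (fun e he => ?_) hx)
  rw [← commutatorElement_inv]
  exact inv_mem (h e he)

/-- Conjugating an entry changes the commutator only by factors of higher weight. This removes the
conjugations from the Hall–Witt identity. -/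
theorem commutator_conj_mem_iff {m n l : ℕ} (hl : 1 ≤ l) {T : Subgroup F}
    (hT : cseries ⊤ (m + n + 1) ≤ T) {u z w : F} (hu : u ∈ cseries (⊤ : Subgroup F) m)
    (hz : z ∈ cseries (⊤ : Subgroup F) n) (hw : w ∈ cseries (⊤ : Subgroup F) l) :
    ⁅u, w * z * w⁻¹⁆ ∈ T ↔ ⁅u, z⁆ ∈ T := by
  have key : ⁅u, w * z * w⁻¹⁆ = ⁅u, ⁅w, z⁆⁆ * ⁅⁅w, z⁆, ⁅u, z⁆⁆ * ⁅u, z⁆ := by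
    simp only [commutatorElement_def]; group
  rw [key]
  have h1 := commutator_mem_cseries hw hz le_rfl
  have h2 := commutator_mem_cseries hu hz le_rfl
  exact Subgroup.mul_mem_cancel_left _ (mul_mem
    (hT (commutator_mem_cseries hu h1 (by omega))) (hT (commutator_mem_cseries h1 h2 (by omega))))

/-- The Jacobi identity for membership in a subgroup containing the next term of the series. -/
theorem commutator_commutator_mem_of_jacobi {p q r : ℕ} (hp : 1 ≤ p) (hq : 1 ≤ q) (hr : 1 ≤ r)
    {T : Subgroup F} (hT : cseries ⊤ (p + q + r + 1) ≤ T) {x y z : F}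
    (hx : x ∈ cseries (⊤ : Subgroup F) p) (hy : y ∈ cseries (⊤ : Subgroup F) q)
    (hz : z ∈ cseries (⊤ : Subgroup F) r) (h1 : ⁅⁅x, z⁆, y⁆ ∈ T) (h2 : ⁅x, ⁅y, z⁆⁆ ∈ T) :
    ⁅⁅x, y⁆, z⁆ ∈ T := by
  have hxy := commutator_mem_cseries hx hy le_rfl
  have hyz := commutator_mem_cseries hy hz le_rfl
  have hzx := commutator_mem_cseries hz hx le_rfl
  have h1' : ⁅⁅z, x⁆, y⁆ ∈ T := by
    refine commutator_closure_left_mem (E := {⁅x, z⁆}) (m := p + r) (n := q) (by omega)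
      ((cseries_antitone _ (by omega)).trans hT)
      (by simpa using commutator_mem_cseries hx hz le_rfl) hy (by simpa using h1) ?_
    rw [← commutatorElement_inv x z]
    exact inv_mem (Subgroup.mem_closure_singleton_self _)
  have h2' : ⁅⁅y, z⁆, x⁆ ∈ T := by
    rw [← commutatorElement_inv]
    exact inv_mem h2
  -- The Hall–Witt identity.
  have key : ⁅⁅x, y⁆, y * z * y⁻¹⁆ * ⁅⁅y, z⁆, z * x * z⁻¹⁆ * ⁅⁅z, x⁆, x * y * x⁻¹⁆ = 1 := by
    simp only [commutatorElement_def]; group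
  rw [← commutator_conj_mem_iff hq hT hxy hz hy]
  rw [← commutator_conj_mem_iff hr ((cseries_antitone _ (by omega)).trans hT)
    hyz hx hz] at h2'
  rw [← commutator_conj_mem_iff hp ((cseries_antitone _ (by omega)).trans hT)
    hzx hy hx] at h1'
  rw [mul_assoc, mul_eq_one_iff_eq_inv] at key
  rw [key]
  exact inv_mem (mul_mem h2' h1')

theorem commutatorElement_pow_left_of_commute {x z : F} (h : Commute x ⁅x, z⁆) (N : ℕ) :
    ⁅x ^ N, z⁆ = ⁅x, z⁆ ^ N := by
  induction N with
  | zero => simp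
  | succ N ih =>
    have key : ⁅x ^ (N + 1), z⁆ = x ^ N * ⁅x, z⁆ * (x ^ N)⁻¹ * ⁅x ^ N, z⁆ := by
      rw [pow_succ]; simp only [commutatorElement_def]; group
    rw [key, (h.pow_left N).eq, mul_inv_cancel_right, ih, pow_succ']

end Multilinear

/-! ### Basic commutators generate the lower central factors -/

section GroupEval

variable {F : Type*} [Group F] {X : Type*}

/-- The value of a formal commutator in a group. -/
def groupEval (y : X → F) : FreeMagma X → F
  | .of i => y i
  | .mul b a => ⁅groupEval y b, groupEval y a⁆

theorem groupEval_mul (y : X → F) (b a : FreeMagma X) :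
    groupEval y (b * a) = ⁅groupEval y b, groupEval y a⁆ := rfl

theorem groupEval_mem (y : X → F) (t : FreeMagma X) :
    groupEval y t ∈ cseries (⊤ : Subgroup F) t.length := by
  induction t with
  | ih1 x => exact Subgroup.mem_top _
  | ih2 b a hb ha => exact commutator_mem_cseries hb ha le_rfl

/-- Modulo the term of R in weight w, a commutator [x, z] of weight w commutes with x, since [x, [x,
z]] has weight above w and [F, F] ≤ R. Hence [x, z]^N ≡ [x^N, z], and the N-th power can be pushed
down to the letter j. -/
theorem groupEval_pow_mem {R : Subgroup F} [R.Normal] (hR : _root_.commutator F ≤ R) (y : X → F)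
    {j : X} {N : ℕ} (hj : y j ^ N ∈ R) (t : FreeMagma X) (ht : j ∈ foliage t) :
    groupEval y t ^ N ∈ cseries R t.length := by
  have step : ∀ {x z : F} {m n : ℕ}, x ∈ cseries (⊤ : Subgroup F) (m + 1) →
      z ∈ cseries (⊤ : Subgroup F) (n + 1) → x ^ N ∈ cseries R (m + 1) →
      ⁅x, z⁆ ^ N ∈ cseries R (m + 1 + (n + 1)) := by
    intro x z m n hx hz h
    have h1 : Commute (x : F ⧸ cseries R (m + 1 + (n + 1))) ⁅(x : F ⧸ cseries R (m + 1 + (n + 1))),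
        (z : F ⧸ cseries R (m + 1 + (n + 1)))⁆ := by
      rw [← commutatorElement_eq_one_iff_commute]
      have h0 : ⁅x, ⁅x, z⁆⁆ ∈ cseries R (m + 1 + (n + 1)) :=
        cseries_antitone R (by omega) (cseries_top_succ_le hR (m + n + 1)
          (commutator_mem_cseries hx (commutator_mem_cseries hx hz le_rfl) (by omega)))
      exact (QuotientGroup.eq_one_iff _).2 h0
    have h2 := commutatorElement_pow_left_of_commute h1 N
    have h3 : ⁅x ^ N, z⁆ ∈ cseries R (m + 1 + (n + 1)) := commutator_mem_cseries' h hz le_rfl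
    rw [← QuotientGroup.eq_one_iff] at h3 ⊢
    exact h2.symm.trans h3
  induction t with
  | ih1 x =>
    obtain rfl : j = x := by simpa [foliage] using ht
    exact hj
  | ih2 b a hb ha =>
    obtain ⟨m, hm⟩ := Nat.exists_eq_add_of_le' b.length_pos
    obtain ⟨n, hn⟩ := Nat.exists_eq_add_of_le' a.length_pos
    have hbm := groupEval_mem y b
    have han := groupEval_mem y a
    rw [groupEval_mul]
    change _ ∈ cseries R (b.length + a.length)
    rw [hm] at hb hbm ⊢
    rw [hn] at ha han ⊢
    rcases List.mem_append.1 (show j ∈ foliage b ++ foliage a from ht) with h | h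
    · exact step hbm han (hb h)
    · rw [← commutatorElement_inv, inv_pow, add_comm]
      exact inv_mem (step han hbm (ha h))

variable [LinearOrder X]

/-- The subgroup generated, modulo the next term of the lower central series, by the basic
commutators `[p, q]` of weight `n` with `a ≤ q`. -/
def basicSpan (y : X → F) (n : ℕ) (a : FreeMagma X) : Subgroup F :=
  Subgroup.closure (groupEval y '' {t | IsBasicCommutator t ∧ t.length = n ∧
    ∃ p q, t = p * q ∧ a ≤ q} ∪ cseries (⊤ : Subgroup F) (n + 1))

theorem cseries_le_basicSpan (y : X → F) (n : ℕ) (a : FreeMagma X) :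
    cseries ⊤ (n + 1) ≤ basicSpan y n a :=
  fun _ hx => Subgroup.subset_closure (Or.inr hx)

theorem basicSpan_anti (y : X → F) (n : ℕ) {a a' : FreeMagma X} (h : a ≤ a') :
    basicSpan y n a' ≤ basicSpan y n a := by
  refine Subgroup.closure_mono (Set.union_subset_union_left _ (Set.image_mono ?_))
  rintro t ⟨h1, h2, p, q, h3, h4⟩
  exact ⟨h1, h2, p, q, h3, h.trans h4⟩

theorem basicSpan_generators_subset (y : X → F) (n : ℕ) (a : FreeMagma X) :
    groupEval y '' {t | IsBasicCommutator t ∧ t.length = n ∧ ∃ p q, t = p * q ∧ a ≤ q} ∪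
      cseries (⊤ : Subgroup F) (n + 1) ⊆ cseries (⊤ : Subgroup F) n := by
  rintro _ (⟨t, ⟨-, rfl, -⟩, rfl⟩ | h)
  · exact groupEval_mem y t
  · exact cseries_antitone _ n.le_succ h

/-- A commutator of two basic commutators is a combination of basic commutators modulo the next
term of the lower central series. -/
theorem groupEval_mul_mem_basicSpan [Finite X] (y : X → F) (n : ℕ) (a b : FreeMagma X)
    (ha : IsBasicCommutator a) (hb : IsBasicCommutator b) (hab : a < b)
    (hn : b.length + a.length = n) : groupEval y (b * a) ∈ basicSpan y n a := by
  induction n using Nat.strong_induction_on generalizing a b with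
  | _ n IH =>
  have hfin : Finite {t : FreeMagma X // t.length ≤ n} := (finite_length n).to_subtype
  obtain ⟨a', haa'⟩ : ∃ a' : {t : FreeMagma X // t.length ≤ n}, a'.1 = a := ⟨⟨a, by omega⟩, rfl⟩
  revert a b
  -- Inside the induction on weight, a descending induction on the right entry a: only finitely many
  -- formal commutators have weight at most n.
  refine WellFounded.induction (C := fun a' : {t : FreeMagma X // t.length ≤ n} =>
    ∀ a b : FreeMagma X, IsBasicCommutator a → IsBasicCommutator b → a < b →
      b.length + a.length = n → a'.1 = a → groupEval y (b * a) ∈ basicSpan y n a)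
    wellFounded_gt a' ?_
  intro a' IH' a b ha hb hab hn haa'
  subst haa'
  obtain ⟨a, han⟩ := a'
  dsimp only at *
  have basic : RightLE b a → groupEval y (b * a) ∈ basicSpan y n a := fun h =>
    Subgroup.subset_closure (Or.inl ⟨b * a, ⟨isBasic_mul.2 ⟨hb, ha, hab, h⟩, hn, b, a, rfl, le_rfl⟩,
      rfl⟩)
  cases b with
  | of x => exact basic trivial
  | mul b₁ b₂ =>
  rcases le_or_gt b₂ a with h | h
  · exact basic (rightLE_mul.2 h)
  have hn' : b₁.length + b₂.length + a.length = n := hn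
  obtain ⟨hb₁, hb₂, hlt, -⟩ := isBasic_mul.1 hb
  have p1 := b₁.length_pos
  have p2 := b₂.length_pos
  have p3 := a.length_pos
  -- For a < b₂, Jacobi trades [[b₁, b₂], a] for [[b₁, a], b₂] and [b₁, [b₂, a]]. The inner brackets
  -- expand, by induction on weight, into basic [p, q] with a ≤ q < [p, q], so only brackets of two
  -- basic commutators greater than a remain. The bound a ≤ q in `basicSpan` is there for this.
  have pair : ∀ s t : FreeMagma X, IsBasicCommutator s → IsBasicCommutator t → a < s → a < t →
      s.length + t.length = n → ⁅groupEval y s, groupEval y t⁆ ∈ basicSpan y n a := by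
    intro s t hs ht has hat hst
    rcases lt_trichotomy s t with hlt | rfl | hlt
    · rw [← commutatorElement_inv]
      exact inv_mem (basicSpan_anti y n has.le
        (IH' ⟨s, by omega⟩ has s t hs ht hlt (by omega) rfl))
    · simp
    · exact basicSpan_anti y n hat.le (IH' ⟨t, by omega⟩ hat t s ht hs hlt hst rfl)
  refine commutator_commutator_mem_of_jacobi p1 p2 p3 ?_ (groupEval_mem y b₁) (groupEval_mem y b₂)
    (groupEval_mem y a) ?_ ?_
  · rw [hn']
    exact cseries_le_basicSpan y n a
  · refine commutator_closure_left_mem (m := b₁.length + a.length) (n := b₂.length) (by omega)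
      ((cseries_antitone _ (by omega)).trans (cseries_le_basicSpan y n a))
      (basicSpan_generators_subset y _ a)
      (groupEval_mem y b₂) ?_ (IH _ (by omega) a b₁ ha hb₁ (h.trans hlt) rfl)
    rintro _ (⟨t, ⟨ht, htl, p, q, rfl, hq⟩, rfl⟩ | he)
    · exact pair _ _ ht hb₂ (hq.trans_lt (lt_mul_right p q)) h (by omega)
    · exact cseries_le_basicSpan y n a
        (commutator_mem_cseries he (groupEval_mem y b₂) (by omega))
  · refine commutator_closure_right_mem (m := b₂.length + a.length) (n := b₁.length) (by omega)
      ((cseries_antitone _ (by omega)).trans (cseries_le_basicSpan y n a))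
      (basicSpan_generators_subset y _ a)
      (groupEval_mem y b₁) ?_ (IH _ (by omega) a b₂ ha hb₂ h rfl)
    rintro _ (⟨t, ⟨ht, htl, p, q, rfl, hq⟩, rfl⟩ | he)
    · exact pair _ _ hb₁ ht (h.trans hlt) (hq.trans_lt (lt_mul_right p q)) (by omega)
    · exact cseries_le_basicSpan y n a
        (commutator_mem_cseries (groupEval_mem y b₁) he (by omega))

/-- If the `y i` generate `F` modulo `R ≥ [F, F]`, then the basic commutators of weight `n` in the
`y i` generate the `n`-th term of the lower central series modulo `[R, F, …, F]`. -/
theorem cseries_top_le_closure [Finite X] {R : Subgroup F} [R.Normal]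
    (hR : _root_.commutator F ≤ R) (y : X → F)
    (hy : Subgroup.closure (Set.range y ∪ R) = ⊤) (n : ℕ) :
    cseries (⊤ : Subgroup F) (n + 1) ≤ Subgroup.closure
      (groupEval y '' {t | IsBasicCommutator t ∧ t.length = n + 1} ∪ cseries R (n + 1)) := by
  induction n with
  | zero =>
    change ⊤ ≤ _
    rw [← hy]
    refine Subgroup.closure_mono (Set.union_subset_union_left _ ?_)
    rintro _ ⟨i, rfl⟩
    exact ⟨.of i, ⟨trivial, rfl⟩, rfl⟩
  | succ n ih =>
    set T := Subgroup.closure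
      (groupEval y '' {t | IsBasicCommutator t ∧ t.length = n + 1 + 1} ∪ cseries R (n + 1 + 1))
    have hD : cseries R (n + 2) ≤ T := fun x hx => Subgroup.subset_closure (Or.inr hx)
    have hT : cseries ⊤ (n + 1 + 1 + 1) ≤ T := (cseries_top_succ_le hR (n + 1)).trans hD
    have hspan : ∀ a, basicSpan y (n + 2) a ≤ T := by
      refine fun a => (Subgroup.closure_le _).2 ?_
      rintro _ (⟨t, ⟨ht, htl, -⟩, rfl⟩ | h)
      · exact Subgroup.subset_closure (Or.inl ⟨t, ⟨ht, htl⟩, rfl⟩)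
      · exact hT h
    rw [cseries_succ_succ, Subgroup.commutator_le]
    intro x hx z hz
    refine commutator_closure_left_mem (m := n + 1) (n := 1) (by omega) hT ?_ hz ?_ (ih hx)
    · rintro _ (⟨t, ⟨-, ht⟩, rfl⟩ | h)
      · rw [← ht]
        exact groupEval_mem y t
      · exact cseries_mono le_top _ h
    rintro _ (⟨t, ⟨ht, htl⟩, rfl⟩ | h)
    · have htm := groupEval_mem y t
      rw [htl] at htm
      refine commutator_closure_right_mem (m := 1) (n := n + 1) (z := groupEval y t)
        le_rfl ((cseries_antitone _ (by omega)).trans hT) (Set.subset_univ _) htm ?_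
        (hy.symm ▸ Subgroup.mem_top z)
      rintro _ (⟨i, rfl⟩ | h)
      · change ⁅groupEval y t, groupEval y (.of i)⁆ ∈ T
        rcases lt_trichotomy t (.of i) with hlt | rfl | hlt
        · rw [← commutatorElement_inv]
          exact inv_mem (hspan t (groupEval_mul_mem_basicSpan y (n + 2) t (.of i) ht trivial hlt
            (by rw [htl, FreeMagma.length]; omega)))
        · simp
        · exact hspan _ (groupEval_mul_mem_basicSpan y (n + 2) (.of i) t trivial ht hlt
            (by rw [htl, FreeMagma.length]))
      · exact hD (commutator_mem_cseries (m := n + 1) (n := 1) htm h le_rfl)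
    · exact hD (commutator_mem_cseries' (m := n + 1) (n := 1) h hz le_rfl)

end GroupEval

/-! ### The Magnus representation and its leading coefficients -/

section Magnus

open PowerSeries

variable {A : Type*} [Ring A]

/-- The units of `A⟦X⟧` congruent to `1` modulo `X ^ n`. -/
def congruenceUnits (A : Type*) [Ring A] (n : ℕ) : Subgroup (A⟦X⟧)ˣ where
  carrier := {u | ∃ v : A⟦X⟧, (u : A⟦X⟧) = 1 + X ^ n * v}
  one_mem' := ⟨0, by simp⟩
  mul_mem' := by
    rintro u w ⟨v, hv⟩ ⟨v', hv'⟩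
    refine ⟨v + v' + v * (X ^ n * v'), ?_⟩
    rw [Units.val_mul, hv, hv']
    noncomm_ring
  inv_mem' := by
    rintro u ⟨v, hv⟩
    refine ⟨-(v * (u⁻¹).val), ?_⟩
    have h : ((u : A⟦X⟧) - X ^ n * v) * (u⁻¹).val = 1 * (u⁻¹).val := by
      rw [hv, add_sub_cancel_right]
    rw [sub_mul, Units.mul_inv, one_mul, mul_assoc] at h
    rw [mul_neg, ← sub_eq_add_neg, h]

theorem mem_congruenceUnits {n : ℕ} {u : (A⟦X⟧)ˣ} :
    u ∈ congruenceUnits A n ↔ ∃ v : A⟦X⟧, (u : A⟦X⟧) = 1 + X ^ n * v := Iff.rfl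

theorem coeff_one_add_X_pow_mul {n : ℕ} (hn : 1 ≤ n) (v : A⟦X⟧) :
    coeff n (1 + X ^ n * v) = constantCoeff v := by
  have h := coeff_X_pow_mul v n 0
  rw [zero_add] at h
  rw [map_add, h, coeff_one, if_neg (by omega), zero_add, coeff_zero_eq_constantCoeff_apply]

theorem constantCoeff_of_mem {n : ℕ} (hn : 1 ≤ n) {u : (A⟦X⟧)ˣ} (hu : u ∈ congruenceUnits A n) :
    constantCoeff (u : A⟦X⟧) = 1 := by
  obtain ⟨v, hv⟩ := hu
  rw [hv, map_add, map_mul, map_pow, constantCoeff_X, zero_pow (by omega), zero_mul, add_zero,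
    map_one]

/-- The leading coefficient as a homomorphism. -/
noncomputable def leadHom (A : Type*) [Ring A] (n : ℕ) (hn : 1 ≤ n) :
    congruenceUnits A n →* Multiplicative A :=
  MonoidHom.mk' (fun u => Multiplicative.ofAdd (coeff n (u.1 : A⟦X⟧))) (by
    rintro ⟨u, v, hv⟩ ⟨w, v', hv'⟩
    rw [← ofAdd_add]
    congr 1
    have h : ((u * w : (A⟦X⟧)ˣ) : A⟦X⟧) = 1 + X ^ n * (v + v' + v * (X ^ n * v')) := by
      rw [Units.val_mul, hv, hv']
      noncomm_ring
    change coeff n ((u * w : (A⟦X⟧)ˣ) : A⟦X⟧) = _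
    rw [h, hv, hv', coeff_one_add_X_pow_mul hn, coeff_one_add_X_pow_mul hn,
      coeff_one_add_X_pow_mul hn]
    simp [zero_pow (show n ≠ 0 by omega)])

theorem leadHom_apply (n : ℕ) (hn : 1 ≤ n) (u : congruenceUnits A n) :
    leadHom A n hn u = Multiplicative.ofAdd (coeff n (u.1 : A⟦X⟧)) := rfl

theorem mem_congruenceUnits_succ {n : ℕ} (hn : 1 ≤ n) {u : (A⟦X⟧)ˣ}
    (hu : u ∈ congruenceUnits A n) : u ∈ congruenceUnits A (n + 1) ↔ coeff n (u : A⟦X⟧) = 0 := by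
  obtain ⟨v, hv⟩ := hu
  constructor
  · rintro ⟨w, hw⟩
    have h : (u : A⟦X⟧) = 1 + X ^ n * (X * w) := by rw [hw, pow_succ, mul_assoc]
    rw [h, coeff_one_add_X_pow_mul hn]
    simp
  · intro h
    rw [hv, coeff_one_add_X_pow_mul hn] at h
    obtain ⟨w, rfl⟩ := X_dvd_iff.2 h
    exact ⟨w, by rw [hv, pow_succ, mul_assoc]⟩

/-- Follows from u w = w u + (u w - w u) after multiplication by u⁻¹ w⁻¹; X is central, so u w - w u
is X^(m+n) times the ring commutator of v and v'. -/
theorem commutator_eq_one_add {m n : ℕ} {u w : (A⟦X⟧)ˣ} {v v' : A⟦X⟧}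
    (hu : (u : A⟦X⟧) = 1 + X ^ m * v) (hw : (w : A⟦X⟧) = 1 + X ^ n * v') :
    ((⁅u, w⁆ : (A⟦X⟧)ˣ) : A⟦X⟧) =
      1 + X ^ (m + n) * ((v * v' - v' * v) * ((u⁻¹).val * (w⁻¹).val)) := by
  have h1 : u.val * w.val = w.val * u.val + X ^ (m + n) * (v * v' - v' * v) := by
    have e1 : X ^ m * v * (X ^ n * v') = X ^ (m + n) * (v * v') := by
      rw [mul_assoc, ← mul_assoc v, (commute_X_pow v n).eq, pow_add]
      simp only [mul_assoc]
    have e2 : X ^ n * v' * (X ^ m * v) = X ^ (m + n) * (v' * v) := by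
      rw [mul_assoc, ← mul_assoc v', (commute_X_pow v' m).eq, add_comm m n, pow_add]
      simp only [mul_assoc]
    rw [hu, hw]
    simp only [add_mul, mul_add, one_mul, mul_one, mul_sub, e1, e2]
    abel
  have h2 : ((⁅u, w⁆ : (A⟦X⟧)ˣ) : A⟦X⟧) = u.val * w.val * ((u⁻¹).val * (w⁻¹).val) := by
    simp only [commutatorElement_def, Units.val_mul, mul_assoc]
  have h3 : w.val * u.val * ((u⁻¹).val * (w⁻¹).val) = 1 := by
    rw [mul_assoc, ← mul_assoc (u : A⟦X⟧), Units.mul_inv, one_mul, Units.mul_inv]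
  rw [h2, h1, add_mul, h3, mul_assoc]

theorem commutator_mem_congruenceUnits {m n : ℕ} {u w : (A⟦X⟧)ˣ}
    (hu : u ∈ congruenceUnits A m) (hw : w ∈ congruenceUnits A n) :
    ⁅u, w⁆ ∈ congruenceUnits A (m + n) := by
  obtain ⟨v, hv⟩ := hu
  obtain ⟨v', hv'⟩ := hw
  exact ⟨_, commutator_eq_one_add hv hv'⟩

theorem coeff_commutator {m n : ℕ} (hm : 1 ≤ m) (hn : 1 ≤ n) {u w : (A⟦X⟧)ˣ}
    (hu : u ∈ congruenceUnits A m) (hw : w ∈ congruenceUnits A n) :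
    coeff (m + n) ((⁅u, w⁆ : (A⟦X⟧)ˣ) : A⟦X⟧) =
      coeff m (u : A⟦X⟧) * coeff n (w : A⟦X⟧) - coeff n (w : A⟦X⟧) * coeff m (u : A⟦X⟧) := by
  have h1 := constantCoeff_of_mem hm (inv_mem hu)
  have h2 := constantCoeff_of_mem hn (inv_mem hw)
  obtain ⟨v, hv⟩ := hu
  obtain ⟨v', hv'⟩ := hw
  rw [commutator_eq_one_add hv hv', coeff_one_add_X_pow_mul (by omega), map_mul, map_mul, h1, h2,
    hv, hv', coeff_one_add_X_pow_mul hm, coeff_one_add_X_pow_mul hn]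
  simp

/-- The unit `1 + a X`. -/
noncomputable def oneAddUnit (a : A) : (A⟦X⟧)ˣ where
  val := 1 + X * C a
  inv := mk fun n => (-a) ^ n
  val_inv := by
    ext n
    rw [add_mul, one_mul, mul_assoc]
    cases n with
    | zero => simp
    | succ n => simp [coeff_succ_X_mul, coeff_C_mul, coeff_one, pow_succ']
  inv_val := by
    ext n
    rw [mul_add, mul_one, (commute_X (C a)).eq.symm, ← mul_assoc]
    cases n with
    | zero => simp
    | succ n => simp [coeff_succ_mul_X, coeff_mul_C, coeff_one, pow_succ]

variable {F : Type*} [Group F]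

/-- The Magnus representation with prescribed linear part. -/
theorem exists_magnus [IsFreeGroup F] (l : F →* Multiplicative A) :
    ∃ ρ : F →* (A⟦X⟧)ˣ, ∀ f, ρ f ∈ congruenceUnits A 1 ∧
      coeff 1 (ρ f : A⟦X⟧) = Multiplicative.toAdd (l f) := by
  let ρ₁ : F →* congruenceUnits A 1 := IsFreeGroup.lift fun i =>
    ⟨oneAddUnit (Multiplicative.toAdd (l (IsFreeGroup.of i))), _, by rw [pow_one]; rfl⟩
  have h : (leadHom A 1 le_rfl).comp ρ₁ = l := by
    refine IsFreeGroup.ext_hom fun i => ?_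
    rw [MonoidHom.comp_apply, IsFreeGroup.lift_of, leadHom_apply]
    change Multiplicative.ofAdd (coeff 1 (1 + X * C (Multiplicative.toAdd (l (IsFreeGroup.of i)))))
      = _
    rw [← pow_one X, coeff_one_add_X_pow_mul le_rfl, constantCoeff_C, ofAdd_toAdd]
  exact ⟨(congruenceUnits A 1).subtype.comp ρ₁, fun f => ⟨(ρ₁ f).2, DFunLike.congr_fun h f⟩⟩

/-- The shift s is used with two values: 0 for the whole group, and 1 for a subgroup killed by the
linear part, which gains one degree in every weight. -/
theorem cseries_le_comap {ρ : F →* (A⟦X⟧)ˣ} (hρ : ∀ f, ρ f ∈ congruenceUnits A 1)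
    {R : Subgroup F} {s : ℕ} (hR : R ≤ (congruenceUnits A (1 + s)).comap ρ) (n : ℕ) :
    cseries R (n + 1) ≤ (congruenceUnits A (n + 1 + s)).comap ρ := by
  induction n with
  | zero => rwa [zero_add]
  | succ n ih =>
    rw [cseries_succ_succ, Subgroup.commutator_le]
    intro x hx z _
    rw [Subgroup.mem_comap, map_commutatorElement]
    have := commutator_mem_congruenceUnits (ih hx) (hρ z)
    rwa [show n + 1 + s + 1 = n + 1 + 1 + s by omega] at this

theorem coeff_groupEval {X' : Type*} {ρ : F →* (A⟦X⟧)ˣ} (hρ : ∀ f, ρ f ∈ congruenceUnits A 1)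
    (y : X' → F) (t : FreeMagma X') : ρ (groupEval y t) ∈ congruenceUnits A t.length ∧
      coeff t.length (ρ (groupEval y t) : A⟦X⟧) =
        ringEval (fun i => coeff 1 (ρ (y i) : A⟦X⟧)) t := by
  induction t with
  | ih1 x => exact ⟨hρ _, rfl⟩
  | ih2 b a hb ha =>
    rw [groupEval_mul, map_commutatorElement, ringEval_mul, ← hb.2, ← ha.2]
    exact ⟨commutator_mem_congruenceUnits hb.1 ha.1,
      coeff_commutator b.length_pos a.length_pos hb.1 ha.1⟩

/-- The homomorphism from a term of the lower central series of a free group to a ring which sends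
commutators to Lie brackets, with prescribed linear part. -/
theorem exists_lead [IsFreeGroup F] (l : F →* Multiplicative A) (n : ℕ) :
    ∃ μ : cseries (⊤ : Subgroup F) (n + 1) →* Multiplicative A,
      (∀ (X' : Type) (y : X' → F) (t : FreeMagma X') (ht : groupEval y t ∈ cseries ⊤ (n + 1)),
        t.length = n + 1 → μ ⟨groupEval y t, ht⟩ =
          Multiplicative.ofAdd (ringEval (fun i => Multiplicative.toAdd (l (y i))) t)) ∧
      ∀ (R : Subgroup F), R ≤ l.ker → ∀ x, x.1 ∈ cseries R (n + 1) → μ x = 1 := by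
  obtain ⟨ρ, hρ⟩ := exists_magnus l
  have h1 : ∀ f, ρ f ∈ congruenceUnits A 1 := fun f => (hρ f).1
  have h2 := cseries_le_comap (s := 0) h1 (R := ⊤) (fun f _ => h1 f) n
  refine ⟨(leadHom A (n + 1) (by omega)).comp
    ((ρ.comp (cseries ⊤ (n + 1)).subtype).codRestrict (congruenceUnits A (n + 1))
      fun x => h2 x.2), ?_, ?_⟩
  · intro X' y t ht htl
    have h3 := (coeff_groupEval h1 y t).2
    rw [htl] at h3
    rw [MonoidHom.comp_apply, leadHom_apply]
    change Multiplicative.ofAdd (coeff (n + 1) (ρ (groupEval y t) : A⟦X⟧)) = _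
    rw [h3]
    simp only [(hρ _).2]
  · intro R hR x hx
    have h3 : R ≤ (congruenceUnits A (1 + 1)).comap ρ := fun r hr =>
      (mem_congruenceUnits_succ le_rfl (h1 r)).2 (by rw [(hρ r).2, (hR hr : l r = 1)]; rfl)
    have h4 := cseries_le_comap h1 h3 n hx
    rw [MonoidHom.comp_apply, leadHom_apply]
    change Multiplicative.ofAdd (coeff (n + 1) (ρ x.1 : A⟦X⟧)) = _
    rw [(mem_congruenceUnits_succ (by omega) (h2 x.2)).1 h4]
    rfl

end Magnus

/-! ### Dependence of ring commutators on their letters -/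

section RingEval

variable {X A : Type*} [Ring A]

theorem ringEval_congr {x x' : X → A} (t : FreeMagma X) (h : ∀ i ∈ foliage t, x i = x' i) :
    ringEval x t = ringEval x' t := by
  induction t with
  | ih1 i => exact h i (by simp [foliage])
  | ih2 b a hb ha =>
    rw [ringEval_mul, ringEval_mul, hb fun i hi => h i (List.mem_append_left _ hi),
      ha fun i hi => h i (List.mem_append_right _ hi)]

theorem ringEval_eq_zero {x : X → A} {i : X} (hi : x i = 0) (t : FreeMagma X)
    (h : i ∈ foliage t) : ringEval x t = 0 := by
  induction t with
  | ih1 j =>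
    obtain rfl : i = j := by simpa [foliage] using h
    exact hi
  | ih2 b a hb ha =>
    rw [ringEval_mul]
    rcases List.mem_append.1 (show i ∈ foliage b ++ foliage a from h) with h | h
    · simp [hb h]
    · simp [ha h]

end RingEval

/-! ### The greatest letter -/

section MaxLetter

variable {X : Type*} [LinearOrder X]

/-- The greatest letter of a formal commutator. -/
def maxLetter : FreeMagma X → X
  | .of x => x
  | .mul b a => max (maxLetter b) (maxLetter a)

theorem maxLetter_mul (b a : FreeMagma X) :
    maxLetter (b * a) = max (maxLetter b) (maxLetter a) := rfl

theorem maxLetter_mem_foliage (t : FreeMagma X) : maxLetter t ∈ foliage t := by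
  induction t with
  | ih1 x => simp [foliage, maxLetter]
  | ih2 b a hb ha =>
    rcases max_choice (maxLetter b) (maxLetter a) with h | h <;> rw [maxLetter_mul, h]
    · exact List.mem_append_left _ hb
    · exact List.mem_append_right _ ha

theorem le_maxLetter (t : FreeMagma X) : ∀ i ∈ foliage t, i ≤ maxLetter t := by
  induction t with
  | ih1 x => simp [foliage, maxLetter]
  | ih2 b a hb ha =>
    intro i hi
    rcases List.mem_append.1 (show i ∈ foliage b ++ foliage a from hi) with h | h
    · exact (hb i h).trans (le_max_left _ _)
    · exact (ha i h).trans (le_max_right _ _)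

end MaxLetter

/-! ### Generators of a product of cyclic groups -/

section Product

variable {ι : Type*} [Fintype ι] [DecidableEq ι] {d : ι → ℕ}

theorem addSubgroup_eq_top_of_single_mem (H : AddSubgroup ((i : ι) → ZMod (d i)))
    (h : ∀ i, Pi.single i 1 ∈ H) : H = ⊤ := by
  refine eq_top_iff.2 fun g _ => ?_
  rw [← Finset.univ_sum_single g]
  refine sum_mem fun i _ => ?_
  obtain ⟨a, ha⟩ := ZMod.intCast_surjective (g i)
  have h1 : Pi.single i (g i) = a • (Pi.single i 1 : (i : ι) → ZMod (d i)) := by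
    rw [← Pi.single_smul, zsmul_one, ha]
  rw [h1]
  exact H.zsmul_mem (h i) a

theorem subgroup_eq_top_of_single_mem (H : Subgroup (Multiplicative ((i : ι) → ZMod (d i))))
    (h : ∀ i, Multiplicative.ofAdd (Pi.single i 1) ∈ H) : H = ⊤ := by
  have h1 := addSubgroup_eq_top_of_single_mem (Subgroup.toAddSubgroup' H) h
  refine eq_top_iff.2 fun g _ => ?_
  have h2 : Multiplicative.toAdd g ∈ Subgroup.toAddSubgroup' H := h1 ▸ AddSubgroup.mem_top _
  exact h2

end Product

/-! ### The factor group γ/[R, F, …, F] -/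

section Core

/-- Basic commutators of weight `n`. -/
abbrev Basic (X : Type*) [LinearOrder X] (n : ℕ) : Type _ :=
  {t : FreeMagma X // IsBasicCommutator t ∧ t.length = n}

variable {X : Type} [LinearOrder X] [Fintype X] {d : X → ℕ}

/-- The linear part of the Magnus representation attached to the letter `j`: letters greater than
`j` are sent to `0`. -/
noncomputable def linearPart (hd : ∀ i j, i ≤ j → d j ∣ d i) (j : X) :
    ((i : X) → ZMod (d i)) →+ MonoidAlgebra (ZMod (d j)) (FreeMonoid X) :=
  -- Reduction from ℤ/d(i) to ℤ/d(j) needs d(j) ∣ d(i), which holds for i ≤ j. Larger letters can be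
  -- dropped because j will be the greatest letter of the commutator being detected.
  ∑ i : X, if h : i ≤ j then
    (((smulAddHom (ZMod (d j)) (MonoidAlgebra (ZMod (d j)) (FreeMonoid X))).flip
      (letter (ZMod (d j)) i)).comp (ZMod.castHom (hd i j h) (ZMod (d j))).toAddMonoidHom).comp
        (Pi.evalAddMonoidHom _ i)
  else 0

theorem linearPart_single (hd : ∀ i j, i ≤ j → d j ∣ d i) (j i : X) :
    linearPart hd j (Pi.single i 1) = if i ≤ j then letter (ZMod (d j)) i else 0 := by
  rw [linearPart, AddMonoidHom.finsetSum_apply, Finset.sum_eq_single i]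
  · split_ifs with h
    · change ZMod.castHom (hd i j h) (ZMod (d j)) ((Pi.single i 1 : (i : X) → ZMod (d i)) i) •
        letter (ZMod (d j)) i = _
      rw [Pi.single_eq_same, map_one, one_smul]
    · rfl
  · intro b _ hb
    split_ifs with h
    · simp [Pi.single_eq_of_ne hb]
    · rfl
  · simp

variable {F : Type*} [Group F]

instance finite_basicCommutators (n : ℕ) : Finite (Basic X n) :=
  ((finite_length n).subset fun _ ht => le_of_eq ht.2).to_subtype

/-- Dual coordinates to the basic commutators of weight `n + 1` on a term of the lower central
series of a free group. -/
theorem exists_coordinates [IsFreeGroup F] (hd : ∀ i j, i ≤ j → d j ∣ d i)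
    (φ : F →* Multiplicative ((i : X) → ZMod (d i))) (y : X → F)
    (hy : ∀ i, φ (y i) = Multiplicative.ofAdd (Pi.single i 1)) (n : ℕ) :
    ∃ Ψ : cseries (⊤ : Subgroup F) (n + 1) →*
        Multiplicative ((t : Basic X (n + 1)) → ZMod (d (maxLetter t.1))),
      (∀ (t : Basic X (n + 1)) (ht : groupEval y t.1 ∈ cseries ⊤ (n + 1)),
        Ψ ⟨groupEval y t.1, ht⟩ = Multiplicative.ofAdd (Pi.single t 1)) ∧
      ∀ x, x.1 ∈ cseries φ.ker (n + 1) → Ψ x = 1 := by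
  have key : ∀ t : Basic X (n + 1), ∃ μ : cseries (⊤ : Subgroup F) (n + 1) →*
      Multiplicative (ZMod (d (maxLetter t.1))),
      (∀ (s : Basic X (n + 1)) (hs : groupEval y s.1 ∈ cseries ⊤ (n + 1)),
        μ ⟨groupEval y s.1, hs⟩ = Multiplicative.ofAdd (if s = t then 1 else 0)) ∧
      ∀ x, x.1 ∈ cseries φ.ker (n + 1) → μ x = 1 := by
    intro t
    set j := maxLetter t.1 with hj
    obtain ⟨ψ, hψ⟩ := exists_dual_basicCommutators (X := X) (ZMod (d j)) (n + 1)
    obtain ⟨μ, hμ, hμ'⟩ := exists_lead ((AddMonoidHom.toMultiplicative (linearPart hd j)).comp φ) n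
    refine ⟨(AddMonoidHom.toMultiplicative (ψ t.1).toAddMonoidHom).comp μ, ?_, ?_⟩
    · intro s hs
      rw [MonoidHom.comp_apply, hμ X y s.1 hs s.2.2]
      have h1 : ∀ i, Multiplicative.toAdd (((AddMonoidHom.toMultiplicative
          (linearPart hd j)).comp φ) (y i)) = if i ≤ j then letter (ZMod (d j)) i else 0 := by
        intro i
        rw [MonoidHom.comp_apply, hy, ← linearPart_single hd]
        rfl
      simp only [h1]
      change Multiplicative.ofAdd (ψ t.1 (ringEval _ s.1)) = _
      congr 1
      -- If s has no letter beyond j, its value is the one in the free algebra and duality applies.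
      -- Otherwise its value is 0, and s ≠ t because the letters of t are at most j.
      by_cases h : ∀ i ∈ foliage s.1, i ≤ j
      · rw [ringEval_congr s.1 (x' := letter (ZMod (d j))) fun i hi => if_pos (h i hi),
          hψ s.1 t.1 s.2.1 s.2.2 t.2.1 t.2.2]
        simp only [Subtype.ext_iff]
      · push Not at h
        obtain ⟨i, hi, hij⟩ := h
        rw [ringEval_eq_zero (i := i) (if_neg (not_le.2 hij)) _ hi, map_zero, if_neg]
        rintro rfl
        exact absurd (le_maxLetter _ i hi) (not_le.2 hij)
    · intro x hx
      rw [MonoidHom.comp_apply, hμ' φ.ker (fun r hr => ?_) x hx, map_one]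
      rw [MonoidHom.mem_ker, MonoidHom.comp_apply, (hr : φ r = 1), map_one]
  choose μ hμ hμ' using key
  refine ⟨MonoidHom.mk' (fun x => Multiplicative.ofAdd fun t => Multiplicative.toAdd (μ t x))
    (fun x z => by simp only [map_mul, toAdd_mul]; rfl), ?_, ?_⟩
  · intro t ht
    refine congrArg Multiplicative.ofAdd (funext fun s => ?_)
    rw [hμ s t ht, toAdd_ofAdd]
    by_cases h : s = t
    · subst h; simp
    · rw [Pi.single_eq_of_ne h, if_neg (Ne.symm h)]
  · intro x hx
    refine congrArg Multiplicative.ofAdd (funext fun s => ?_)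
    rw [hμ' s x hx]
    rfl

/-- For a free group `F` mapping onto `∏ i, ℤ / d i` with kernel `R`, where `d j ∣ d i` for `i ≤ j`,
the quotient of a term of the lower central series by `[R, F, …, F]` is the product of the
`ℤ / d (maxLetter t)` over the basic commutators `t`. -/
theorem nonempty_cseries_quotient_equiv [IsFreeGroup F] (hd : ∀ i j, i ≤ j → d j ∣ d i)
    (φ : F →* Multiplicative ((i : X) → ZMod (d i))) (hφ : Function.Surjective φ) (n : ℕ) :
    Nonempty ((↥(cseries (⊤ : Subgroup F) (n + 1)) ⧸
        (cseries φ.ker (n + 1)).subgroupOf (cseries ⊤ (n + 1))) ≃*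
      Multiplicative ((t : Basic X (n + 1)) → ZMod (d (maxLetter t.1)))) := by
  classical
  have : Fintype (Basic X (n + 1)) := Fintype.ofFinite _
  choose y hy using fun i => hφ (Multiplicative.ofAdd (Pi.single i 1))
  have hR : _root_.commutator F ≤ φ.ker := Abelianization.commutator_subset_ker φ
  have hgen : Subgroup.closure (Set.range y ∪ φ.ker) = ⊤ := by
    set H := Subgroup.closure (Set.range y ∪ φ.ker)
    have h1 : H.map φ = ⊤ := subgroup_eq_top_of_single_mem _ fun i =>
      ⟨y i, Subgroup.subset_closure (Or.inl ⟨i, rfl⟩), hy i⟩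
    refine eq_top_iff.2 fun f _ => ?_
    obtain ⟨h, hh, hhf⟩ := (h1 ▸ Subgroup.mem_top (φ f) : φ f ∈ H.map φ)
    have h2 : h⁻¹ * f ∈ H :=
      Subgroup.subset_closure (Or.inr (by simp [MonoidHom.mem_ker, hhf]))
    have h3 := mul_mem hh h2
    rwa [mul_inv_cancel_left] at h3
  let Γ := cseries (⊤ : Subgroup F) (n + 1)
  let D := cseries φ.ker (n + 1)
  obtain ⟨Ψ, hΨ, hΨ'⟩ := exists_coordinates hd φ y hy n
  have hDΓ : D ≤ Γ := cseries_mono le_top _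
  have hg : ∀ t : Basic X (n + 1), groupEval y t.1 ∈ Γ := fun t => by
    have := groupEval_mem y t.1
    rwa [t.2.2] at this
  let g : Basic X (n + 1) → Γ := fun t => ⟨groupEval y t.1, hg t⟩
  have hsurj : Function.Surjective Ψ := by
    rw [← MonoidHom.range_eq_top]
    exact subgroup_eq_top_of_single_mem _ fun t => ⟨g t, hΨ t (hg t)⟩
  let N := D.subgroupOf Γ
  -- Commutators of elements of Γ have weight at least n + 2, and [F, F] ≤ R puts that term of the
  -- lower central series inside D.
  let : CommGroup (Γ ⧸ N) :=
    { (inferInstance : Group (Γ ⧸ N)) with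
      mul_comm := by
        rintro ⟨x⟩ ⟨z⟩
        change ((x : Γ ⧸ N) * z) = z * x
        rw [← commutatorElement_eq_one_iff_mul_comm]
        have h1 : ⁅x, z⁆ ∈ N := by
          rw [Subgroup.mem_subgroupOf]
          exact cseries_top_succ_le hR n (commutator_mem_cseries x.2 z.2 (by omega))
        exact (QuotientGroup.eq_one_iff _).2 h1 }
  let p : Γ →* Γ ⧸ N := QuotientGroup.mk' N
  have hp : ∀ x : Γ, p x = 1 ↔ x.1 ∈ D := fun x =>
    (QuotientGroup.eq_one_iff x).trans Subgroup.mem_subgroupOf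
  have hexp : ∀ x ∈ Subgroup.closure
      (groupEval y '' {t | IsBasicCommutator t ∧ t.length = n + 1} ∪ D), ∀ hx : x ∈ Γ,
      ∃ a : Basic X (n + 1) → ℤ, p ⟨x, hx⟩ = ∏ t, p (g t) ^ a t := by
    have hle : Subgroup.closure
        (groupEval y '' {t | IsBasicCommutator t ∧ t.length = n + 1} ∪ D) ≤ Γ := by
      refine (Subgroup.closure_le _).2 ?_
      rintro _ (⟨t, ht, rfl⟩ | h)
      exacts [hg ⟨t, ht⟩, hDΓ h]
    intro x hx
    induction hx using Subgroup.closure_induction with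
    | mem x hx =>
      intro hxΓ
      rcases hx with ⟨t, ht, rfl⟩ | h
      · refine ⟨Pi.single ⟨t, ht⟩ 1, ?_⟩
        rw [Finset.prod_eq_single ⟨t, ht⟩]
        · simp [g]
        · intro s _ hs
          rw [Pi.single_eq_of_ne hs, zpow_zero]
        · simp
      · exact ⟨0, by simpa using (hp ⟨x, hxΓ⟩).2 h⟩
    | one => exact fun h => ⟨0, by simpa using (hp ⟨1, h⟩).2 (one_mem D)⟩
    | mul x z hx hz ihx ihz =>
      intro _
      obtain ⟨a, ha⟩ := ihx (hle hx)
      obtain ⟨b, hb⟩ := ihz (hle hz)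
      refine ⟨a + b, ?_⟩
      simp only [Pi.add_apply, zpow_add, Finset.prod_mul_distrib]
      rw [← ha, ← hb, ← map_mul]
      rfl
    | inv x hx ihx =>
      intro _
      obtain ⟨a, ha⟩ := ihx (hle hx)
      refine ⟨-a, ?_⟩
      simp only [Pi.neg_apply, zpow_neg, Finset.prod_inv_distrib]
      rw [← ha, ← map_inv]
      rfl
  have hker : N = Ψ.ker := by
    ext x
    rw [Subgroup.mem_subgroupOf, MonoidHom.mem_ker]
    refine ⟨hΨ' x, fun hx => ?_⟩
    obtain ⟨a, ha⟩ := hexp x.1 (cseries_top_le_closure hR y hgen n x.2) x.2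
    let Ψ' : Γ ⧸ N →* Multiplicative ((t : Basic X (n + 1)) → ZMod (d (maxLetter t.1))) :=
      QuotientGroup.lift N Ψ fun x hx => hΨ' x (Subgroup.mem_subgroupOf.1 hx)
    have h1 : Ψ x = ∏ t, Ψ (g t) ^ a t := by
      have := congrArg Ψ' ha
      rw [map_prod] at this
      simp only [map_zpow] at this
      exact this
    rw [hx] at h1
    -- The coordinate of Ψ at t is the exponent of t modulo d(maxLetter t), so an element of the
    -- kernel has all its exponents divisible; those powers already lie in D.
    have h2 : ∀ t, (a t : ZMod (d (maxLetter t.1))) = 0 := by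
      intro t
      have h3 := congrFun (congrArg Multiplicative.toAdd h1) t
      rw [toAdd_prod, Finset.sum_apply, Finset.sum_eq_single t] at h3
      · rw [hΨ t (hg t), toAdd_zpow, toAdd_ofAdd] at h3
        simpa using h3.symm
      · intro s _ hs
        rw [hΨ s (hg s), toAdd_zpow, toAdd_ofAdd]
        simp [Pi.single_eq_of_ne hs.symm]
      · simp
    rw [← hp, ha]
    refine Finset.prod_eq_one fun t _ => ?_
    obtain ⟨b, hb⟩ := (ZMod.intCast_zmod_eq_zero_iff_dvd _ _).1 (h2 t)
    rw [hb, zpow_mul, zpow_natCast, ← map_pow, (hp _).2, one_zpow]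
    change groupEval y t.1 ^ _ ∈ D
    have h4 := groupEval_pow_mem hR y (j := maxLetter t.1) (N := d (maxLetter t.1)) ?_ t.1
      (maxLetter_mem_foliage _)
    · rwa [t.2.2] at h4
    · rw [MonoidHom.mem_ker, map_pow, hy, ← ofAdd_nsmul, ← Pi.single_smul, nsmul_one,
        ZMod.natCast_self, Pi.single_zero, ofAdd_zero]
  exact ⟨(QuotientGroup.quotientMulEquivOfEq hker).trans
    (QuotientGroup.quotientKerEquivOfSurjective Ψ hsurj)⟩

end Core

/-! ### Verbal and marginal subgroups for nilpotent varieties -/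

section Marginal

theorem cseries_top_le_comap {K F : Type*} [Group K] [Group F] (α : K →* F) (n : ℕ) :
    cseries (⊤ : Subgroup K) (n + 1) ≤ (cseries ⊤ (n + 1)).comap α := by
  rw [← Subgroup.map_le_iff_le_comap, cseries_top_succ, cseries_top_succ,
    Subgroup.map_lowerCentralSeries]
  exact Subgroup.lowerCentralSeries_mono n le_top

theorem mem_nilpotentWords {c : ℕ} {w : FreeGroup ℕ} :
    w ∈ nilpotentWords c ↔ w ∈ cseries (⊤ : Subgroup (FreeGroup ℕ)) (c + 1) := by
  constructor
  · intro hw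
    rw [cseries_top_succ]
    -- The relatively free group of class c on countably many letters tests all laws at once.
    let L := (⊤ : Subgroup (FreeGroup ℕ)).lowerCentralSeries c
    have hbot : (⊤ : Subgroup (FreeGroup ℕ ⧸ L)).lowerCentralSeries c = ⊥ := by
      rw [← Subgroup.map_top_of_surjective (QuotientGroup.mk' L) (QuotientGroup.mk'_surjective L),
        ← Subgroup.map_lowerCentralSeries, Subgroup.map_eq_bot_iff, QuotientGroup.ker_mk']
    have : Group.IsNilpotent (FreeGroup ℕ ⧸ L) := Subgroup.nilpotent_iff_lowerCentralSeries.2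
      ⟨c, hbot⟩
    have h := hw (FreeGroup ℕ ⧸ L)
      (Subgroup.lowerCentralSeries_eq_bot_iff_nilpotencyClass_le.1 hbot)
      fun i => QuotientGroup.mk' L (FreeGroup.of i)
    have h1 : FreeGroup.lift (fun i => QuotientGroup.mk' L (FreeGroup.of i))
        = QuotientGroup.mk' L := by
      ext i
      simp
    rw [h1] at h
    exact (QuotientGroup.eq_one_iff w).1 h
  · intro hw H _ _ hH f
    have h := cseries_top_le_comap (FreeGroup.lift f) c hw
    rw [cseries_top_succ, Subgroup.lowerCentralSeries_eq_bot_iff_nilpotencyClass_le.2 hH] at h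
    exact h

/-- Two homomorphisms which agree modulo `R` agree on the terms of the lower central series modulo
`[R, F, …, F]`. -/
theorem mul_inv_mem_cseries {K F : Type*} [Group K] [Group F] {R : Subgroup F} [R.Normal]
    {α β : K →* F} (h : ∀ k, α k * (β k)⁻¹ ∈ R) (n : ℕ) {k : K}
    (hk : k ∈ cseries (⊤ : Subgroup K) (n + 1)) : α k * (β k)⁻¹ ∈ cseries R (n + 1) := by
  induction n generalizing k with
  | zero => exact h k
  | succ n ih =>
    let q := QuotientGroup.mk' (cseries R (n + 2))
    have hE : ∀ k, k ∈ (q.comp α).eqLocus (q.comp β) ↔ α k * (β k)⁻¹ ∈ cseries R (n + 2) := by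
      intro k
      rw [← QuotientGroup.eq_one_iff (N := cseries R (n + 2))]
      change q (α k) = q (β k) ↔ q (α k * (β k)⁻¹) = 1
      rw [map_mul, map_inv, mul_inv_eq_one]
    rw [← hE]
    refine (Subgroup.commutator_le.2 fun x hx z _ => ?_ :
      cseries ⊤ (n + 2) ≤ (q.comp α).eqLocus (q.comp β)) hk
    rw [hE, map_commutatorElement, map_commutatorElement]
    obtain ⟨d, hd⟩ : ∃ d, d = α x * (β x)⁻¹ := ⟨_, rfl⟩
    obtain ⟨r, hr⟩ : ∃ r, r = α z * (β z)⁻¹ := ⟨_, rfl⟩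
    have hdm : d ∈ cseries R (n + 1) := hd ▸ ih hx
    have hrm : r ∈ cseries R 1 := hr ▸ h z
    have hβx : β x ∈ cseries ⊤ (n + 1) := cseries_top_le_comap β n hx
    have htop : ∀ f : F, f ∈ cseries (⊤ : Subgroup F) 1 := fun f => Subgroup.mem_top f
    rw [show α x = d * β x by rw [hd, inv_mul_cancel_right],
      show α z = r * β z by rw [hr, inv_mul_cancel_right]]
    -- Each factor on the right is a commutator, up to conjugation, with an entry d or r from the
    -- series of R, and of total weight at least n + 2.
    have key : ⁅d * β x, r * β z⁆ * ⁅β x, β z⁆⁻¹ =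
        ⁅d, ⁅β x, r * β z⁆⁆ * ⁅β x, r⁆ * ⁅r, ⁅β x, β z⁆⁆ *
          (⁅β x, β z⁆ * ⁅d, r * β z⁆ * ⁅β x, β z⁆⁻¹) := by
      simp only [commutatorElement_def]
      group
    rw [key]
    refine mul_mem (mul_mem (mul_mem ?_ ?_) ?_) (Subgroup.Normal.conj_mem inferInstance _ ?_ _)
    · exact commutator_mem_cseries' hdm (htop _) le_rfl
    · exact commutator_mem_cseries hβx hrm le_rfl
    · exact commutator_mem_cseries' hrm (commutator_mem_cseries hβx (htop _) le_rfl) (by omega)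
    · exact commutator_mem_cseries' hdm (htop _) le_rfl

/-- The left-normed commutator `[f 0, f 1, …, f n]`. -/
def leftNormed {F : Type*} [Group F] (f : ℕ → F) : ℕ → F
  | 0 => f 0
  | n + 1 => ⁅leftNormed f n, f (n + 1)⁆

theorem leftNormed_congr {F : Type*} [Group F] {f g : ℕ → F} {n : ℕ}
    (h : ∀ i ≤ n, f i = g i) : leftNormed f n = leftNormed g n := by
  induction n with
  | zero => exact h 0 le_rfl
  | succ n ih => rw [leftNormed, leftNormed, ih fun i hi => h i (by omega), h (n + 1) le_rfl]

theorem map_leftNormed {K F : Type*} [Group K] [Group F] (α : K →* F) (f : ℕ → K) (n : ℕ) :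
    α (leftNormed f n) = leftNormed (fun i => α (f i)) n := by
  induction n with
  | zero => rfl
  | succ n ih => rw [leftNormed, leftNormed, map_commutatorElement, ih]

theorem leftNormed_mem {F : Type*} [Group F] (f : ℕ → F) (n : ℕ) :
    leftNormed f n ∈ cseries (⊤ : Subgroup F) (n + 1) := by
  induction n with
  | zero => exact Subgroup.mem_top _
  | succ n ih => exact Subgroup.commutator_mem_commutator ih (Subgroup.mem_top _)

/-- An element of [R, F, …, F] is a product of commutators whose left entries are themselves
products. The upper central series of F/N avoids expanding these: if all left-normed commutators of
full length vanish in F/N, shorter ones lie in successively higher centres, and centres are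
subgroups. -/
theorem cseries_le_of_leftNormed_mem {F : Type*} [Group F] {R N : Subgroup F} [N.Normal] {c : ℕ}
    (h : ∀ f : ℕ → F, f 0 ∈ R → leftNormed f c ∈ N) : cseries R (c + 1) ≤ N := by
  let q := QuotientGroup.mk' N
  have h1 : ∀ k n, n + k = c → ∀ f : ℕ → F, f 0 ∈ R →
      q (leftNormed f n) ∈ Subgroup.upperCentralSeries (F ⧸ N) k := by
    intro k
    induction k with
    | zero =>
      rintro n rfl f hf
      exact Subgroup.mem_bot.2 ((QuotientGroup.eq_one_iff _).2 (h f hf))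
    | succ k ih =>
      intro n hn f hf
      rw [Subgroup.mem_upperCentralSeries_succ_iff]
      intro z
      obtain ⟨z, rfl⟩ := QuotientGroup.mk'_surjective N z
      have h2 := ih (n + 1) (by omega) (Function.update f (n + 1) z)
        (by rwa [Function.update_of_ne (by omega)])
      rw [leftNormed, Function.update_self, map_commutatorElement,
        leftNormed_congr (g := f) fun i hi => Function.update_of_ne (by omega) _ _] at h2
      exact h2
  have h2 : ∀ n k, n + k = c →
      cseries R (n + 1) ≤ (Subgroup.upperCentralSeries (F ⧸ N) k).comap q := by
    intro n
    induction n with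
    | zero =>
      rintro k hk r hr
      exact h1 k 0 hk (fun _ => r) hr
    | succ n ih =>
      intro k hk
      rw [cseries_succ_succ, Subgroup.commutator_le]
      intro x hx z _
      rw [Subgroup.mem_comap, map_commutatorElement]
      exact Subgroup.mem_upperCentralSeries_succ_iff.1 (ih (k + 1) (by omega) hx) _
  intro x hx
  exact (QuotientGroup.eq_one_iff x).1 (Subgroup.mem_bot.1 (h2 c 0 rfl hx))

variable {F : Type*} [Group F]

/-- For the variety of nilpotent groups of class at most `c`, `[R V* F] = [R, F, …, F]`. -/
theorem marginalCommutator_nilpotentWords (c : ℕ) (R : Subgroup F) [R.Normal] :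
    marginalCommutator (nilpotentWords c) R = cseries R (c + 1) := by
  refine le_antisymm ((Subgroup.closure_le _).2 ?_) (cseries_le_of_leftNormed_mem fun f hf => ?_)
  · rintro _ ⟨v, hv, f, i, r, hr, rfl⟩
    refine mul_inv_mem_cseries (fun k => ?_) c (mem_nilpotentWords.1 hv)
    have h : (QuotientGroup.mk' R).comp (FreeGroup.lift (Function.update f i (f i * r)))
        = (QuotientGroup.mk' R).comp (FreeGroup.lift f) := by
      ext j
      by_cases hj : j = i
      · subst hj
        simp [hr]
      · simp [hj]
    have h2 := DFunLike.congr_fun h k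
    rw [← QuotientGroup.eq_one_iff]
    simpa [mul_inv_eq_one] using h2
  · have hg : leftNormed (Function.update f 0 1) c = 1 := by
      clear hf
      induction c with
      | zero => simp [leftNormed]
      | succ c ih => rw [leftNormed, ih, commutatorElement_one_left]
    -- Perturbing the entry 1 in the first place by f 0 ∈ R yields the left-normed commutator of f,
    -- while the unperturbed value is trivial.
    refine Subgroup.subset_closure ⟨leftNormed FreeGroup.of c,
      mem_nilpotentWords.2 (leftNormed_mem _ c), Function.update f 0 1, 0, f 0, hf, ?_⟩
    simp [map_leftNormed, hg]

/-- The verbal subgroup of the variety of nilpotent groups of class at most `c`. -/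
theorem verbalSubgroup_nilpotentWords (c : ℕ) :
    verbalSubgroup (nilpotentWords c) F = cseries ⊤ (c + 1) := by
  refine le_antisymm ((Subgroup.closure_le _).2 ?_) ?_
  · rintro _ ⟨v, hv, f, rfl⟩
    exact cseries_top_le_comap (FreeGroup.lift f) c (mem_nilpotentWords.1 hv)
  · rw [← marginalCommutator_nilpotentWords]
    exact (marginalCommutator_le _ _).trans inf_le_right

end Marginal

/-! ### Counting basic commutators by greatest letter -/

section Counting

theorem maxLetter_map {X Y : Type*} [LinearOrder X] [LinearOrder Y] {e : X → Y} (he : StrictMono e)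
    (t : FreeMagma X) : maxLetter (FreeMagma.map e t) = e (maxLetter t) := by
  induction t with
  | ih1 x => rfl
  | ih2 b a hb ha =>
    rw [map_mul, maxLetter_mul, maxLetter_mul, hb, ha, he.monotone.map_max]

theorem map_lt_map {X Y : Type*} [LinearOrder X] [LinearOrder Y] {e : X → Y} (he : StrictMono e)
    {s t : FreeMagma X} : FreeMagma.map e s < FreeMagma.map e t ↔ s < t :=
  (show StrictMono (FreeMagma.map e) from
    fun _ _ h => commLT_map (fun _ _ h => he h) h).lt_iff_lt

theorem isBasic_of_map {X Y : Type*} [LinearOrder X] [LinearOrder Y] {e : X → Y}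
    (he : StrictMono e) {t : FreeMagma X} (h : IsBasicCommutator (FreeMagma.map e t)) :
    IsBasicCommutator t := by
  induction t with
  | ih1 x => trivial
  | ih2 b a hb ha =>
    rw [map_mul, isBasic_mul] at h
    refine isBasic_mul.2 ⟨hb h.1, ha h.2.1, (map_lt_map he).1 h.2.2.1, ?_⟩
    cases b with
    | of x => trivial
    | mul b₁ b₂ =>
      have h1 : FreeMagma.map e b₂ ≤ FreeMagma.map e a := rightLE_mul.1 h.2.2.2
      exact rightLE_mul.2 (not_lt.1 fun h2 => not_lt.2 h1 ((map_lt_map he).2 h2))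

theorem exists_map_castLE {i r : ℕ} (hir : i ≤ r) (t : FreeMagma (Fin r))
    (ht : (maxLetter t).val < i) : ∃ s, FreeMagma.map (Fin.castLE hir) s = t := by
  induction t with
  | ih1 x => exact ⟨.of ⟨x, ht⟩, rfl⟩
  | ih2 b a hb ha =>
    rw [maxLetter_mul] at ht
    obtain ⟨b', rfl⟩ := hb ((Fin.le_def.1 (le_max_left _ _)).trans_lt ht)
    obtain ⟨a', rfl⟩ := ha ((Fin.le_def.1 (le_max_right _ _)).trans_lt ht)
    exact ⟨b' * a', map_mul _ _ _⟩

theorem card_maxLetter_lt (n : ℕ) {i r : ℕ} (hir : i ≤ r) :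
    Nat.card {t : Basic (Fin r) n // (maxLetter t.1).val < i} = numBasicCommutators n i := by
  have he : StrictMono (Fin.castLE hir) := fun _ _ h => h
  refine (Nat.card_congr (Equiv.ofBijective
    (fun t : Basic (Fin i) n => (⟨⟨FreeMagma.map (Fin.castLE hir) t.1,
      isBasic_map (fun _ _ h => he h) t.2.1, (length_map _ _).trans t.2.2⟩, ?_⟩ :
        {t : Basic (Fin r) n // (maxLetter t.1).val < i})) ⟨?_, ?_⟩)).symm
  · rw [maxLetter_map he]
    exact (maxLetter t.1).2
  · intro s t h
    exact Subtype.ext (map_injective he.injective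
      (congrArg (fun u : {t : Basic (Fin r) n // (maxLetter t.1).val < i} => u.1.1) h))
  · rintro ⟨⟨t, ht, htn⟩, hti⟩
    obtain ⟨s, rfl⟩ := exists_map_castLE hir t hti
    exact ⟨⟨s, isBasic_of_map he ht, (length_map _ _).symm.trans htn⟩, rfl⟩

/-- Basic commutators with greatest letter below i are exactly those on the first i letters. Letters
are numbered from 0, so greatest letter j means lying on the first j + 1 letters but not on the
first j. -/
theorem card_maxLetter_eq (n : ℕ) {r : ℕ} (j : Fin r) :
    Nat.card {t : Basic (Fin r) n // maxLetter t.1 = j} =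
      numBasicCommutators n (j + 1) - numBasicCommutators n j := by
  have h1 := card_maxLetter_lt n (Nat.succ_le_of_lt j.2)
  have h2 := card_maxLetter_lt n j.2.le
  have h3 : {t : Basic (Fin r) n | (maxLetter t.1).val < j + 1} =
      {t | (maxLetter t.1).val < j.val} ∪ {t | maxLetter t.1 = j} := by
    ext t
    simp only [Set.mem_ofPred_eq, Set.mem_union, Fin.ext_iff]
    omega
  have h4 : Disjoint {t : Basic (Fin r) n | (maxLetter t.1).val < j.val}
      {t | maxLetter t.1 = j} := by
    rw [Set.disjoint_left]
    rintro t h rfl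
    exact absurd h (lt_irrefl (maxLetter t.1).val)
  have h5 := Set.ncard_union_eq h4 (Set.toFinite _) (Set.toFinite _)
  rw [← h3, ← Nat.card_coe_set_eq, ← Nat.card_coe_set_eq, ← Nat.card_coe_set_eq] at h5
  change Nat.card {t : Basic (Fin r) n // (maxLetter t.1).val < j + 1} =
    Nat.card {t : Basic (Fin r) n // (maxLetter t.1).val < j.val} +
      Nat.card {t : Basic (Fin r) n // maxLetter t.1 = j} at h5
  rw [← h1, ← h2]
  exact (Nat.sub_eq_of_eq_add' h5).symm

/-- The basic commutators on `m + k` letters, sorted by their greatest letter. -/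
theorem exists_equiv_basic (n m k : ℕ) :
    ∃ e : Fin (numBasicCommutators n m) ⊕ ((i : Fin k) × Fin (numBasicCommutators n (m + i + 1)
        - numBasicCommutators n (m + i))) ≃ Basic (Fin (m + k)) n,
      (∀ x, (maxLetter (e (.inl x)).1).val < m) ∧
      ∀ p, maxLetter (e (.inr p)).1 = Fin.natAdd m p.1 := by
  let e₀ := (Finite.equivFinOfCardEq (card_maxLetter_lt n (Nat.le_add_right m k))).symm
  let e₁ := fun i : Fin k => (Finite.equivFinOfCardEq (card_maxLetter_eq n (Fin.natAdd m i))).symm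
  have hbij : Function.Bijective (Sum.elim (fun x => (e₀ x).1) (fun p => (e₁ p.1 p.2).1) :
      Fin (numBasicCommutators n m) ⊕ ((i : Fin k) × Fin (numBasicCommutators n (m + i + 1)
        - numBasicCommutators n (m + i))) → Basic (Fin (m + k)) n) := by
    constructor
    · rintro (x | ⟨i, x⟩) (z | ⟨j, z⟩) h
      · exact congrArg _ (e₀.injective (Subtype.ext h))
      · have h1 := (e₀ x).2
        rw [show (e₀ x).1 = (e₁ j z).1 from h, (e₁ j z).2] at h1
        exact absurd h1 (by simp)
      · have h1 := (e₀ z).2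
        rw [← show (e₁ i x).1 = (e₀ z).1 from h, (e₁ i x).2] at h1
        exact absurd h1 (by simp)
      · have h1 := (e₁ i x).2
        rw [show (e₁ i x).1 = (e₁ j z).1 from h, (e₁ j z).2] at h1
        obtain rfl : j = i := Fin.natAdd_injective _ _ h1
        exact congrArg (fun x => Sum.inr (Sigma.mk j x)) ((e₁ j).injective (Subtype.ext h))
    · intro t
      rcases lt_or_ge (maxLetter t.1).val m with h | h
      · exact ⟨.inl (e₀.symm ⟨t, h⟩), by simp⟩
      · have hj : maxLetter t.1 = Fin.natAdd m ⟨maxLetter t.1 - m, by omega⟩ := by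
          ext
          simp only [Fin.natAdd_mk]
          omega
        exact ⟨.inr ⟨_, (e₁ _).symm ⟨t, hj⟩⟩, by simp⟩
  exact ⟨Equiv.ofBijective _ hbij, fun x => (e₀ x).2, fun p => (e₁ p.1 p.2).2⟩

theorem isBasic_fin_one (t : FreeMagma (Fin 1)) (ht : IsBasicCommutator t) : t = .of 0 := by
  induction t with
  | ih1 x => rw [Subsingleton.elim x 0]
  | ih2 b a hb ha =>
    obtain ⟨h1, h2, h3, -⟩ := isBasic_mul.1 ht
    rw [hb h1, ha h2] at h3
    exact absurd h3 (lt_irrefl _)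

theorem numBasicCommutators_one {n : ℕ} (hn : 2 ≤ n) : numBasicCommutators n 1 = 0 := by
  have : IsEmpty {t : FreeMagma (Fin 1) // IsBasicCommutator t ∧ t.length = n} := by
    refine ⟨fun t => ?_⟩
    have h := t.2.2
    rw [isBasic_fin_one _ t.2.1, FreeMagma.length] at h
    omega
  exact Nat.card_of_isEmpty

theorem numBasicCommutators_zero (n : ℕ) : numBasicCommutators n 0 = 0 := by
  have : IsEmpty {t : FreeMagma (Fin 0) // IsBasicCommutator t ∧ t.length = n} :=
    ⟨fun t => (maxLetter t.1).elim0⟩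
  exact Nat.card_of_isEmpty

end Counting

/-! ### Rearranging products of cyclic groups -/

section Assembly

/-- Splitting a product of cyclic groups into the infinite factors and the others. -/
noncomputable def piZModEquiv {T A B : Type*} (e : A ⊕ B ≃ T) {δ : T → ℕ} {ν : B → ℕ}
    (h₀ : ∀ a, δ (e (.inl a)) = 0) (h₁ : ∀ b, δ (e (.inr b)) = ν b) :
    ((t : T) → ZMod (δ t)) ≃+ (A → ℤ) × ((b : B) → ZMod (ν b)) :=
  let e₁ : ((t : T) → ZMod (δ t)) ≃+ ((s : A ⊕ B) → ZMod (δ (e s))) :=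
    { Equiv.piCongrLeft' (fun t => ZMod (δ t)) e.symm with map_add' := fun _ _ => rfl }
  let e₂ : ((s : A ⊕ B) → ZMod (δ (e s))) ≃+
      ((a : A) → ZMod (δ (e (.inl a)))) × ((b : B) → ZMod (δ (e (.inr b)))) :=
    { Equiv.sumPiEquivProdPi (fun s => ZMod (δ (e s))) with map_add' := fun _ _ => rfl }
  (e₁.trans e₂).trans (AddEquiv.prodCongr
    (AddEquiv.piCongrRight fun a => (ZMod.ringEquivCongr (h₀ a)).toAddEquiv)
    (AddEquiv.piCongrRight fun b => (ZMod.ringEquivCongr (h₁ b)).toAddEquiv))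

/-- Currying as an additive equivalence. -/
def piCurryAddEquiv {α : Type*} {β : α → Type*} (γ : α → Type*) [∀ a, AddCommGroup (γ a)] :
    ((p : (a : α) × β a) → γ p.1) ≃+ ((a : α) → β a → γ a) :=
  { Equiv.piCurry (fun a (_ : β a) => γ a) with map_add' := fun _ _ => rfl }

theorem nonempty_quotient_equiv_of_eq {F : Type*} [Group F] {H H' N N' : Subgroup F} [N.Normal]
    [N'.Normal] (hH : H = H') (hN : N = N') :
    Nonempty (↥H ⧸ N.subgroupOf H ≃* ↥H' ⧸ N'.subgroupOf H') := by
  subst hH hN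
  exact ⟨MulEquiv.refl _⟩

theorem dvd_of_le {k : ℕ} {n : Fin k → ℕ}
    (hn : ∀ i j : Fin k, (j : ℕ) = (i : ℕ) + 1 → n j ∣ n i) {i j : Fin k} (hij : i ≤ j) :
    n j ∣ n i := by
  obtain ⟨l, hl⟩ := Nat.exists_eq_add_of_le (Fin.le_def.1 hij)
  induction l generalizing j with
  | zero => rw [Fin.ext (a := j) (b := i) hl]
  | succ l ih =>
    exact (hn ⟨i + l, by omega⟩ j (by rw [hl]; rfl)).trans
      (ih (Fin.le_def.2 (Nat.le_add_right _ _)) rfl)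

end Assembly

end BaerInv

theorem theorem1p1 (c m k : ℕ) (hc : 1 ≤ c) (n : Fin k → ℕ)
    (hn : ∀ i j : Fin k, (j : ℕ) = (i : ℕ) + 1 → n j ∣ n i)
    {G : Type*} [Group G]
    (hG : Nonempty (G ≃* Multiplicative ((Fin m → ℤ) × ((i : Fin k) → ZMod (n i)))))
    {F : Type*} [Group F] [IsFreeGroup F] (R : Subgroup F) [R.Normal]
    (hR : Nonempty (G ≃* F ⧸ R)) :
    BaerInv.numBasicCommutators (c + 1) 0 = 0 ∧ BaerInv.numBasicCommutators (c + 1) 1 = 0 ∧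
    Nonempty (BaerInv.NilpotentMultiplier c R ≃*
      Multiplicative ((Fin (BaerInv.numBasicCommutators (c + 1) m) → ℤ) ×
        ((i : Fin k) → Fin (BaerInv.numBasicCommutators (c + 1) (m + i + 1)
          - BaerInv.numBasicCommutators (c + 1) (m + i)) → ZMod (n i)))) := by
  refine ⟨BaerInv.numBasicCommutators_zero _, BaerInv.numBasicCommutators_one (by omega), ?_⟩
  obtain ⟨eG⟩ := hG
  obtain ⟨eR⟩ := hR
  -- The infinite factors come first with modulus 0: everything divides 0, so the divisibility chain
  -- extends over all m + k letters.
  let d : Fin (m + k) → ℕ := Fin.append (fun _ => 0) n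
  have hd₀ : ∀ i : Fin (m + k), i.val < m → d i = 0 := fun i hi =>
    Fin.append_left (fun _ => 0) n ⟨i, hi⟩
  have hd₁ : ∀ i, d (Fin.natAdd m i) = n i := fun i => Fin.append_right _ _ _
  have hd : ∀ i j, i ≤ j → d j ∣ d i := by
    intro i j hij
    rcases lt_or_ge (i : ℕ) m with hi | hi
    · rw [hd₀ i hi]
      exact dvd_zero _
    · have hij' := Fin.le_def.1 hij
      have h1 : i = Fin.natAdd m ⟨i - m, by omega⟩ := by ext; simp only [Fin.natAdd_mk]; omega
      have h2 : j = Fin.natAdd m ⟨j - m, by omega⟩ := by ext; simp only [Fin.natAdd_mk]; omega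
      rw [h1, h2, hd₁, hd₁]
      exact BaerInv.dvd_of_le hn (Fin.le_def.2 (Nat.sub_le_sub_right hij' m))
  let eD : ((i : Fin (m + k)) → ZMod (d i)) ≃+ (Fin m → ℤ) × ((i : Fin k) → ZMod (n i)) :=
    BaerInv.piZModEquiv finSumFinEquiv (fun i => hd₀ _ (by simp)) (fun i => hd₁ i)
  let E : F ⧸ R ≃* Multiplicative ((i : Fin (m + k)) → ZMod (d i)) :=
    (eR.symm.trans eG).trans (AddEquiv.toMultiplicative eD.symm)
  let φ := E.toMonoidHom.comp (QuotientGroup.mk' R)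
  have hker : R = φ.ker := by
    ext f
    rw [MonoidHom.mem_ker, MonoidHom.comp_apply]
    exact (QuotientGroup.eq_one_iff f).symm.trans (map_eq_one_iff E E.injective).symm
  obtain ⟨e, he₀, he₁⟩ := BaerInv.exists_equiv_basic (c + 1) m k
  obtain ⟨e₁⟩ := BaerInv.nonempty_cseries_quotient_equiv hd φ
    (E.surjective.comp (QuotientGroup.mk'_surjective R)) c
  -- Here c ≥ 1 enters: γ lies in [F, F], which lies in R because G is abelian.
  have hle : BaerInv.cseries (⊤ : Subgroup F) (c + 1) ≤ R := by
    obtain ⟨c, rfl⟩ := Nat.exists_eq_add_of_le' hc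
    have h1 : commutator F ≤ R := hker ▸ Abelianization.commutator_subset_ker φ
    exact (BaerInv.cseries_top_succ_le h1 c).trans (BaerInv.cseries_antitone R (Nat.zero_le _))
  obtain ⟨e₂⟩ := BaerInv.nonempty_quotient_equiv_of_eq
    (H := R ⊓ BaerInv.verbalSubgroup (BaerInv.nilpotentWords c) F)
    (H' := BaerInv.cseries ⊤ (c + 1))
    (N := BaerInv.marginalCommutator (BaerInv.nilpotentWords c) R)
    (N' := BaerInv.cseries φ.ker (c + 1))
    (by rw [BaerInv.verbalSubgroup_nilpotentWords, inf_eq_right.2 hle])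
    (by rw [BaerInv.marginalCommutator_nilpotentWords, ← hker])
  exact ⟨(e₂.trans e₁).trans (AddEquiv.toMultiplicative
    ((BaerInv.piZModEquiv e (δ := fun t => d (BaerInv.maxLetter t.1)) (ν := fun p => n p.1)
      (fun x => hd₀ _ (he₀ x)) (fun p => by rw [he₁, hd₁])).trans
    (AddEquiv.prodCongr (AddEquiv.refl _) (BaerInv.piCurryAddEquiv fun i => ZMod (n i)))))⟩
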